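/- Let $\mathbb{K}$ be a commutative ring. A dg-module is an $\mathbb{N}$-graded $\mathbb{K}$-module with a differential of degree $-1$; a dg-$\Sigma_*$-module $M$ is a sequence of dg-modules $M(n)$, $n\in\mathbb{N}$, with actions of the symmetric groups $\Sigma_n$; a morphism of dg-$\Sigma_*$-modules is a quasi-isomorphism if it induces an isomorphism in homology in each arity $n$. The composition product is $(M\circ N)(n)=\bigoplus_{r\ge 0}\bigl(\bigoplus_{J_1\amalg\cdots\amalg J_r=\{1,\ldots,n\}}M(r)\otimes N(J_1)\otimes\cdots\otimes N(J_r)\bigr)_{\Sigma_r}$. A dg-operad $P$ is connected if $P(0)=0$ and $P(1)=\mathbb{K}\,1$ (free on the operad unit). The indecomposable quotient of a left module $R$ over a connected dg-operad $P$ is the dg-$\Sigma_*$-module $I\circ_P R$, that is, the quotient of $R$ by the dg-$\Sigma_*$-submodule generated by the composites $p(y_1,\ldots,y_r)$ with $p\in P(r)$, $r\neq 1$. A left $P$-module $R$ is quasi-free, written $R=P\circ\bar R$, if for some dg-$\Sigma_*$-module $\bar R$ it is the free graded left $P$-module $P\circ\bar R$ equipped with a differential $\delta+d_\theta$ which satisfies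 the derivation relation with respect to the action of $P$, where $\delta$ is the canonical differential of $P\circ\bar R$ and where the composite $\bar R\subset P\circ\bar R\xrightarrow{d_\theta}P\circ\bar R\to\bar R$ vanishes; then $\bar R$ is identified with the indecomposable quotient of $R$. \textbf{Theorem.} Let $\phi:P\to P'$ be a morphism of connected dg-operads. Let $R=P\circ\bar R$ be a quasi-free left $P$-module and $R'=P'\circ\bar R'$ a quasi-free left $P'$-module, with $\bar R(0)=\bar R'(0)=0$, and let $\psi:R\to R'$ be a morphism of left $P$-modules, where $R'$ is a left $P$-module by restriction of structure along $\phi$. Assume that the $\mathbb{K}$-modules $\bar R(n)$ and $\bar R'(n)$ are projective for all $n$ (which is automatic if $\mathbb{K}$ is a field). Let $\bar\psi:\bar R\to\bar R'$ be the morphism of dg-$\Sigma_*$-modules induced by $\psi$ on indecomposable quotients. (a) If $\phi:P\to P'$ and $\bar\psi:\bar R\to\bar R'$ are quasi-isomorphisms, then so is $\psi:R\to R'$. (b) If $\phi:P\to P'$ and $\psi:R\to R'$ are quasi-isomorphisms, then so is $\bar\psi:\bar R\to\bar R'$. (c) Assume in addition that $\bar R(1)=\bar R'(1)=\mathbb{K}$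 (free of rank one, concentrated in degree $0$). If $\psi:R\to R'$ and $\bar\psi:\bar R\to\bar R'$ are quasi-isomorphisms, then so is $\phi:P\to P'$. -/

import Mathlib

open scoped DirectSum TensorProduct

universe u v

namespace OperadicModules

variable {K : Type u} [CommRing K]

/-! ### Differential graded modules -/

/-- A dg-module: an `ℕ`-graded `K`-module `V = ⨁ V_d` (the grading is internal, `gr d = V_d`) with
a differential of degree `-1`. -/
structure DGMod (K : Type u) [CommRing K] where
  carrier : Type v
  [addCommGroup : AddCommGroup carrier]
  [module : Module K carrier]
  gr : ℕ → Submodule K carrier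
  isInternal : DirectSum.IsInternal gr
  d : carrier →ₗ[K] carrier
  d_mem : ∀ (k : ℕ) (x : carrier), x ∈ gr (k + 1) → d x ∈ gr k
  d_zero : ∀ x ∈ gr 0, d x = 0
  d_d : ∀ x, d (d x) = 0

namespace DGMod

instance : CoeSort (DGMod.{u, v} K) (Type v) := ⟨DGMod.carrier⟩

attribute [instance] DGMod.addCommGroup DGMod.module

/-- A morphism of dg-modules: homogeneous of degree `0` and commuting with differentials. -/
structure Hom (V W : DGMod.{u, v} K) where
  toLin : V →ₗ[K] W
  map_mem : ∀ (k : ℕ) (x : V), x ∈ V.gr k → toLin x ∈ W.gr k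
  map_d : ∀ x, toLin (V.d x) = W.d (toLin x)

instance (V W : DGMod.{u, v} K) : CoeFun (Hom V W) (fun _ => V → W) := ⟨fun f => f.toLin⟩

/-- The total homology `H_*(V) = ker d / im d` (the direct sum of the modules `H_k(V)`). -/
abbrev Homology (V : DGMod.{u, v} K) : Type v :=
  LinearMap.ker V.d ⧸ (LinearMap.range V.d).submoduleOf (LinearMap.ker V.d)

/-- The map `f_* : H_*(V) → H_*(W)` induced by a morphism. -/
def Hom.homologyMap {V W : DGMod.{u, v} K} (f : Hom V W) : V.Homology →ₗ[K] W.Homology :=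
  Submodule.mapQ _ _
    (f.toLin.restrict (p := LinearMap.ker V.d) (q := LinearMap.ker W.d) (fun x hx => by
      rw [LinearMap.mem_ker] at hx ⊢
      rw [← f.map_d, hx, map_zero]))
    (by
      rintro ⟨x, hx⟩ ⟨y, hy⟩
      refine ⟨f y, ?_⟩
      rw [← f.map_d]
      exact congrArg f.toLin hy)

def Hom.IsQuasiIso {V W : DGMod.{u, v} K} (f : Hom V W) : Prop :=
  Function.Bijective f.homologyMap

/-- `V = K`: the dg-module `V` is free of rank one over `K`, on a generator of degree `0`. -/
def IsGroundRing (V : DGMod.{u, v} K) : Prop :=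
  ∃ g ∈ V.gr 0, Function.Bijective (fun c : K => c • g)

end DGMod

/-! ### Symmetric modules -/

/-- A dg-`Σ_*`-module: a sequence of dg-modules `M(n)`, with an action of the symmetric group
`Σ_n` on `M(n)` by morphisms of dg-modules.  The action is written as a functor on the groupoid of
the sets `Fin n` and their bijections; a bijection `Fin m ≃ Fin n` exists only for `m = n`, so that
this amounts to a left action of `Equiv.Perm (Fin n)` on `M(n)` for each `n`. -/
structure SymMod (K : Type u) [CommRing K] where
  obj : ℕ → DGMod.{u, v} K
  map : ∀ {m n : ℕ}, (Fin m ≃ Fin n) → DGMod.Hom (obj m) (obj n)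
  map_refl : ∀ (n : ℕ) (x : obj n), map (Equiv.refl (Fin n)) x = x
  map_trans : ∀ {l m n : ℕ} (e : Fin l ≃ Fin m) (f : Fin m ≃ Fin n) (x : obj l),
    map (e.trans f) x = map f (map e x)

namespace SymMod

instance : CoeFun (SymMod.{u, v} K) (fun _ => ℕ → DGMod.{u, v} K) := ⟨SymMod.obj⟩

/-- A morphism of dg-`Σ_*`-modules. -/
structure Hom (M N : SymMod.{u, v} K) where
  app : ∀ n, DGMod.Hom (M n) (N n)
  naturality : ∀ {m n : ℕ} (e : Fin m ≃ Fin n) (x : M m),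
    app n (M.map e x) = N.map e (app m x)

/-- A morphism of dg-`Σ_*`-modules is a quasi-isomorphism if it is one in each arity. -/
def Hom.IsQuasiIso {M N : SymMod.{u, v} K} (f : Hom M N) : Prop :=
  ∀ n, (f.app n).IsQuasiIso

/-- `M` is connected: `M(0) = 0`. -/
def IsConnected (M : SymMod.{u, v} K) : Prop := Subsingleton (M 0)

/-- `M` is projective as a `K`-module. -/
def IsProjective (M : SymMod.{u, v} K) : Prop := ∀ n, Module.Projective K (M n)

end SymMod

/-! ### Signs and permutations -/

/-- The Koszul sign of the reordering `y_1 ⊗ ⋯ ⊗ y_s ↦ y_{w(1)} ⊗ ⋯ ⊗ y_{w(r)}`, for elements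
`y_j` of degree `e j`. -/
def koszulSign (K : Type u) [CommRing K] {r s : ℕ} (w : Fin r ≃ Fin s) (e : Fin s → ℕ) : K :=
  ∏ i : Fin r, ∏ j : Fin r, if i < j ∧ w j < w i then (-1 : K) ^ (e (w i) * e (w j)) else 1

/-- The bijection of the blocks `u_1 ⊔ ⋯ ⊔ u_r`. -/
def sumEquiv {r : ℕ} {m n : Fin r → ℕ} (u : ∀ i, Fin (m i) ≃ Fin (n i)) :
    Fin (∑ i, m i) ≃ Fin (∑ i, n i) :=
  finSigmaFinEquiv.symm.trans ((Equiv.sigmaCongrRight u).trans finSigmaFinEquiv)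

/-- The block permutation determined by `w`: it moves the `i`-th block, of size `n (w i)`, to the
`w i`-th block. -/
def blockEquiv {r s : ℕ} (w : Fin r ≃ Fin s) (n : Fin s → ℕ) :
    Fin (∑ i, n (w i)) ≃ Fin (∑ j, n j) :=
  finSigmaFinEquiv.symm.trans
    ((Equiv.sigmaCongrLeft (β := fun j => Fin (n j)) w).trans finSigmaFinEquiv)

theorem sum_sum_finSigma {r : ℕ} (n : Fin r → ℕ) (m : Fin (∑ i, n i) → ℕ) :
    ∑ i, ∑ a, m (finSigmaFinEquiv ⟨i, a⟩) = ∑ k, m k := by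
  rw [← Equiv.sum_comp finSigmaFinEquiv m, Fintype.sum_sigma]

/-! ### Operads and their left modules -/

/-- A morphism of dg-`Σ_*`-modules `A ∘ B → B`, given by composition products
`A(r) ⊗ B(n_1) ⊗ ⋯ ⊗ B(n_r) → B(n_1 + ⋯ + n_r)`, `(p, y_1, …, y_r) ↦ p(y_1, …, y_r)`, which
preserve degrees, satisfy the derivation relation, and are equivariant (with the signs of the
symmetry isomorphism of dg-modules). -/
structure Action (A B : SymMod.{u, v} K) where
  comp : ∀ {r : ℕ} (n : Fin r → ℕ),
    A r →ₗ[K] MultilinearMap K (fun i => (B (n i) : Type v)) (B (∑ i, n i))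
  comp_mem : ∀ {r : ℕ} (n : Fin r → ℕ) (a : ℕ) (e : Fin r → ℕ) (p : A r) (y : ∀ i, B (n i)),
    p ∈ (A r).gr a → (∀ i, y i ∈ (B (n i)).gr (e i)) →
    comp n p y ∈ (B (∑ i, n i)).gr (a + ∑ i, e i)
  d_comp : ∀ {r : ℕ} (n : Fin r → ℕ) (a : ℕ) (e : Fin r → ℕ) (p : A r) (y : ∀ i, B (n i)),
    p ∈ (A r).gr a → (∀ i, y i ∈ (B (n i)).gr (e i)) →
    (B (∑ i, n i)).d (comp n p y) = comp n ((A r).d p) y +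
      ∑ i, (-1 : K) ^ (a + ∑ j ∈ Finset.Iio i, e j) •
        comp n p (Function.update y i ((B (n i)).d (y i)))
  comp_map_inner : ∀ {r : ℕ} (m n : Fin r → ℕ) (u : ∀ i, Fin (m i) ≃ Fin (n i)) (p : A r)
    (y : ∀ i, B (m i)),
    comp n p (fun i => B.map (u i) (y i)) = B.map (sumEquiv u) (comp m p y)
  comp_map_outer : ∀ {r s : ℕ} (w : Fin r ≃ Fin s) (n : Fin s → ℕ) (e : Fin s → ℕ) (p : A r)
    (y : ∀ j, B (n j)), (∀ j, y j ∈ (B (n j)).gr (e j)) →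
    comp n (A.map w p) y =
      koszulSign K w e • B.map (blockEquiv w n) (comp (fun i => n (w i)) p (fun i => y (w i)))

/-- The associativity relation
`p(q_1, …, q_r)(y_{11}, …, y_{r n_r}) = ± p(q_1(y_{11}, …, y_{1 n_1}), …, q_r(y_{r1}, …, y_{r n_r}))`,
where the sign is produced by the commutation of `q_i` with the `y_{j a}`, `j < i`. -/
def Action.IsAssociative {A B : SymMod.{u, v} K} (μ : Action A A) (ρ : Action A B) : Prop :=
  ∀ {r : ℕ} (n : Fin r → ℕ) (m : Fin (∑ i, n i) → ℕ) (b : Fin r → ℕ) (e : Fin (∑ i, n i) → ℕ)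
    (p : A r) (q : ∀ i, A (n i)) (y : ∀ k, B (m k)),
    (∀ i, q i ∈ (A (n i)).gr (b i)) → (∀ k, y k ∈ (B (m k)).gr (e k)) →
    ρ.comp m (μ.comp n p q) y =
      (-1 : K) ^ (∑ i, ∑ j ∈ Finset.Iio i, b i * ∑ a, e (finSigmaFinEquiv ⟨j, a⟩)) •
        B.map (finCongr (sum_sum_finSigma n m))
          (ρ.comp (fun i => ∑ a, m (finSigmaFinEquiv ⟨i, a⟩)) p
            (fun i => ρ.comp (fun a => m (finSigmaFinEquiv ⟨i, a⟩)) (q i)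
              (fun a => y (finSigmaFinEquiv ⟨i, a⟩))))

/-- The unit relation `1(y) = y`. -/
def Action.IsUnital {A B : SymMod.{u, v} K} (ρ : Action A B) (one : A 1) : Prop :=
  ∀ (n : ℕ) (y : B n),
    ρ.comp (fun _ : Fin 1 => n) one (fun _ => y) =
      B.map (finCongr (Fin.sum_univ_one (fun _ => n)).symm) y

/-- A dg-operad. -/
structure Operad (K : Type u) [CommRing K] extends SymMod.{u, v} K where
  mul : Action toSymMod toSymMod
  one : obj 1
  one_mem : one ∈ (obj 1).gr 0
  assoc : mul.IsAssociative mul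
  one_mul : mul.IsUnital one
  mul_one : ∀ (r : ℕ) (p : obj r),
    mul.comp (fun _ : Fin r => 1) p (fun _ => one) = map (finCongr (by simp)) p

namespace Operad

/-- `P` is connected: `P(0) = 0` and `P(1) = K 1` (free on the operad unit). -/
def IsConnected (P : Operad.{u, v} K) : Prop :=
  Subsingleton (P.obj 0) ∧ Function.Bijective (fun c : K => c • P.one)

/-- A morphism of dg-operads. -/
structure Hom (P Q : Operad.{u, v} K) extends SymMod.Hom P.toSymMod Q.toSymMod where
  map_one : app 1 P.one = Q.one
  map_mul : ∀ {r : ℕ} (n : Fin r → ℕ) (p : P.obj r) (q : ∀ i, P.obj (n i)),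
    app _ (P.mul.comp n p q) = Q.mul.comp n (app r p) (fun i => app (n i) (q i))

end Operad

/-- A (dg-)left module over a dg-operad `P`. -/
structure LeftModule (P : Operad.{u, v} K) extends SymMod.{u, v} K where
  act : Action P.toSymMod toSymMod
  assoc : P.mul.IsAssociative act
  one_act : act.IsUnital P.one

namespace LeftModule

variable {P P' : Operad.{u, v} K}

/-- A morphism of left `P`-modules. -/
structure Hom (R S : LeftModule P) extends SymMod.Hom R.toSymMod S.toSymMod where
  map_act : ∀ {r : ℕ} (n : Fin r → ℕ) (p : P.obj r) (y : ∀ i, R.obj (n i)),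
    app _ (R.act.comp n p y) = S.act.comp n p (fun i => app (n i) (y i))

/-- Restriction of structure: a left `P'`-module is a left `P`-module through `φ : P → P'`. -/
def restrict (φ : Operad.Hom P P') (R : LeftModule P') : LeftModule P where
  toSymMod := R.toSymMod
  act :=
    { comp := fun {r} n => (R.act.comp n).comp (φ.app r).toLin
      comp_mem := fun n a e p y hp hy =>
        R.act.comp_mem n a e _ y ((φ.app _).map_mem a p hp) hy
      d_comp := fun n a e p y hp hy => by
        simp only [LinearMap.comp_apply]
        rw [R.act.d_comp n a e _ y ((φ.app _).map_mem a p hp) hy, (φ.app _).map_d]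
      comp_map_inner := fun m n u p y => R.act.comp_map_inner m n u _ y
      comp_map_outer := fun w n e p y hy => by
        simp only [LinearMap.comp_apply]
        rw [φ.naturality w p]
        exact R.act.comp_map_outer w n e _ y hy }
  assoc := by
    intro r n m b e p q y hq hy
    simp only [LinearMap.comp_apply]
    rw [φ.map_mul]
    exact R.assoc n m b e _ _ y (fun i => (φ.app _).map_mem _ _ (hq i)) hy
  one_act := by
    intro n y
    simp only [LinearMap.comp_apply]
    rw [φ.map_one]
    exact R.one_act n y

/-! ### The indecomposable quotient -/

/-- The decomposable elements of `R(n)`: the submodule spanned by the composites `p(y_1, …, y_r)`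
with `p` in the augmentation ideal of `P`, and by their images under permutations.  For a connected
operad the augmentation ideal consists of the modules `P(r)` with `r ≠ 1`.  By multilinearity it is
enough to take homogeneous elements. -/
def decomposables (R : LeftModule P) (n : ℕ) : Submodule K (R.obj n) :=
  Submodule.span K {z | ∃ (r : ℕ) (k : Fin r → ℕ) (σ : Fin (∑ i, k i) ≃ Fin n) (a : ℕ)
    (e : Fin r → ℕ) (p : P.obj r) (y : ∀ i, R.obj (k i)),
    r ≠ 1 ∧ p ∈ (P.obj r).gr a ∧ (∀ i, y i ∈ (R.obj (k i)).gr (e i)) ∧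
      z = R.map σ (R.act.comp k p y)}

theorem mem_decomposables {R : LeftModule P} {n r : ℕ} {k : Fin r → ℕ}
    (σ : Fin (∑ i, k i) ≃ Fin n) {a : ℕ} {e : Fin r → ℕ} {p : P.obj r} {y : ∀ i, R.obj (k i)}
    (hr : r ≠ 1) (hp : p ∈ (P.obj r).gr a) (hy : ∀ i, y i ∈ (R.obj (k i)).gr (e i)) :
    R.map σ (R.act.comp k p y) ∈ R.decomposables n :=
  Submodule.subset_span ⟨r, k, σ, a, e, p, y, hr, hp, hy, rfl⟩

theorem exists_d_mem (V : DGMod.{u, v} K) {k : ℕ} {x : V} (hx : x ∈ V.gr k) :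
    ∃ l, V.d x ∈ V.gr l := by
  cases k with
  | zero => exact ⟨0, by rw [V.d_zero x hx]; exact zero_mem _⟩
  | succ k => exact ⟨k, V.d_mem k x hx⟩

theorem d_decomposables (R : LeftModule P) (n : ℕ) :
    R.decomposables n ≤ (R.decomposables n).comap (R.obj n).d := by
  refine Submodule.span_le.2 ?_
  rintro _ ⟨r, k, σ, a, e, p, y, hr, hp, hy, rfl⟩
  change (R.obj n).d _ ∈ R.decomposables n
  rw [← (R.map σ).map_d, R.act.d_comp k a e p y hp hy, map_add, map_sum]
  refine add_mem ?_ (sum_mem fun i _ => ?_)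
  · obtain ⟨l, hl⟩ := exists_d_mem _ hp
    exact mem_decomposables σ hr hl hy
  · rw [map_smul]
    refine Submodule.smul_mem _ _ ?_
    obtain ⟨l, hl⟩ := exists_d_mem _ (hy i)
    refine mem_decomposables (e := Function.update e i l) σ hr hp fun j => ?_
    by_cases h : j = i
    · subst h; simpa using hl
    · simpa [Function.update_of_ne h] using hy j

theorem map_decomposables (R : LeftModule P) {m n : ℕ} (τ : Fin m ≃ Fin n) :
    R.decomposables m ≤ (R.decomposables n).comap (R.map τ).toLin := by
  refine Submodule.span_le.2 ?_
  rintro _ ⟨r, k, σ, a, e, p, y, hr, hp, hy, rfl⟩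
  change R.map τ (R.map σ _) ∈ R.decomposables n
  rw [← R.map_trans]
  exact mem_decomposables _ hr hp hy

/-- A quotient of a graded module by a submodule spanned by homogeneous elements is graded. -/
theorem isInternal_quotient (V : DGMod.{u, v} K) (s : Set V)
    (hs : ∀ x ∈ s, ∃ k, x ∈ V.gr k) :
    DirectSum.IsInternal (fun k => (V.gr k).map (Submodule.span K s).mkQ) := by
  classical
  let _ := V.isInternal.chooseDecomposition
  set D := Submodule.span K s with hD
  have hproj : ∀ (k : ℕ) (x : V), x ∈ D → (DirectSum.decompose V.gr x k : V) ∈ D := by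
    intro k x hx
    induction hx using Submodule.span_induction with
    | mem x hx =>
      obtain ⟨l, hl⟩ := hs x hx
      by_cases h : l = k
      · subst h; rw [DirectSum.decompose_of_mem_same _ hl]; exact Submodule.subset_span hx
      · rw [DirectSum.decompose_of_mem_ne _ hl h]; exact zero_mem _
    | zero => simp
    | add x y _ _ hx hy => simpa using add_mem hx hy
    | smul c x _ hx =>
      rw [DirectSum.decompose_smul]
      exact D.smul_mem c hx
  rw [DirectSum.isInternal_submodule_iff_iSupIndep_and_iSup_eq_top]
  constructor
  · rw [iSupIndep_iff_forall_dfinsupp]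
    intro k x f h
    obtain ⟨v, hv, hvx⟩ := x.2
    choose g hg hgf using fun j => (f j).2
    -- compare the degree `k` component of `v` with the one of a sum of elements of degree `≠ k`
    have hsum : ∃ z : V, D.mkQ z = (x : V ⧸ D) ∧ (DirectSum.decompose V.gr z k : V) = 0 := by
      rw [← h, DFinsupp.lsum_apply_apply, DFinsupp.sumAddHom_apply]
      refine ⟨∑ j ∈ (f.erase k).support, g j, ?_, ?_⟩
      · rw [map_sum, DFinsupp.sum]
        refine Finset.sum_congr rfl fun j hj => ?_
        have hjk : j ≠ k := by
          rintro rfl; simp at hj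
        simp [hgf, DFinsupp.erase_ne hjk]
      · rw [DirectSum.decompose_sum, DFinsupp.finsetSum_apply, AddSubmonoidClass.coe_finsetSum]
        refine Finset.sum_eq_zero fun j hj => ?_
        have hjk : j ≠ k := by
          rintro rfl; simp at hj
        exact DirectSum.decompose_of_mem_ne _ (hg j) hjk
    obtain ⟨z, hz, hz0⟩ := hsum
    have hmem : v - z ∈ D := by
      rw [← Submodule.Quotient.eq]
      exact hvx.trans hz.symm
    have := hproj k _ hmem
    rw [DirectSum.decompose_sub, DFinsupp.sub_apply, AddSubgroupClass.coe_sub, hz0, sub_zero,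
      DirectSum.decompose_of_mem_same _ hv] at this
    ext1
    rw [← hvx]
    simpa using this
  · rw [← Submodule.map_iSup, V.isInternal.submodule_iSup_eq_top, Submodule.map_top,
      Submodule.range_mkQ]

theorem homogeneous_decomposables (R : LeftModule P) (n : ℕ) :
    DirectSum.IsInternal (fun k => ((R.obj n).gr k).map (R.decomposables n).mkQ) := by
  refine isInternal_quotient _ _ ?_
  rintro _ ⟨r, k, σ, a, e, p, y, hr, hp, hy, rfl⟩
  exact ⟨_, (R.map σ).map_mem _ _ (R.act.comp_mem k a e p y hp hy)⟩

/-- The dg-module `R̄(n)`: the quotient of `R(n)` by the decomposable elements. -/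
def indecomposablesObj (R : LeftModule P) (n : ℕ) : DGMod.{u, v} K where
  carrier := R.obj n ⧸ R.decomposables n
  gr := fun k => ((R.obj n).gr k).map (R.decomposables n).mkQ
  isInternal := R.homogeneous_decomposables n
  d := (R.decomposables n).mapQ _ (R.obj n).d (R.d_decomposables n)
  d_mem := by
    rintro k _ ⟨x, hx, rfl⟩
    exact ⟨_, (R.obj n).d_mem k x hx, rfl⟩
  d_zero := by
    rintro _ ⟨x, hx, rfl⟩
    exact (congrArg (R.decomposables n).mkQ ((R.obj n).d_zero x hx)).trans (map_zero _)
  d_d := by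
    intro x
    obtain ⟨x, rfl⟩ := Submodule.mkQ_surjective _ x
    exact (congrArg (R.decomposables n).mkQ ((R.obj n).d_d x)).trans (map_zero _)

/-- The morphism of quotients induced by a morphism of dg-modules which preserves decomposable
elements. -/
def indecomposablesDesc (R : LeftModule P) (R' : LeftModule P') {m n : ℕ}
    (f : DGMod.Hom (R.obj m) (R'.obj n))
    (hf : R.decomposables m ≤ (R'.decomposables n).comap f.toLin) :
    DGMod.Hom (R.indecomposablesObj m) (R'.indecomposablesObj n) where
  toLin := (R.decomposables m).mapQ (R'.decomposables n) f.toLin hf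
  map_mem := by
    rintro k _ ⟨x, hx, rfl⟩
    exact ⟨_, f.map_mem k x hx, rfl⟩
  map_d := by
    intro x
    obtain ⟨x, rfl⟩ := Submodule.mkQ_surjective _ x
    exact congrArg (R'.decomposables n).mkQ (f.map_d x)

/-- The indecomposable quotient `R̄ = I ∘_P R` of a left module over a connected operad, with the
differential and the action of symmetric groups induced by those of `R`. -/
def indecomposables (R : LeftModule P) : SymMod.{u, v} K where
  obj := R.indecomposablesObj
  map τ := indecomposablesDesc R R (R.map τ) (R.map_decomposables τ)
  map_refl n x := by
    obtain ⟨x, rfl⟩ := Submodule.mkQ_surjective (R.decomposables n) x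
    exact congrArg (R.decomposables n).mkQ (R.map_refl n x)
  map_trans {l m n} e f x := by
    obtain ⟨x, rfl⟩ := Submodule.mkQ_surjective (R.decomposables l) x
    exact congrArg (R.decomposables n).mkQ (R.map_trans e f x)

/-- The morphism of dg-`Σ_*`-modules underlying a morphism of left `P`-modules `R → R'`, where `R'`
is a left `P'`-module. -/
def Hom.toSymHom {R : LeftModule P} {R' : LeftModule P'} {φ : Operad.Hom P P'}
    (ψ : Hom R (R'.restrict φ)) : SymMod.Hom R.toSymMod R'.toSymMod := ψ.toHom

theorem hom_decomposables {R : LeftModule P} {R' : LeftModule P'} {φ : Operad.Hom P P'}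
    (ψ : Hom R (R'.restrict φ)) (n : ℕ) :
    R.decomposables n ≤ (R'.decomposables n).comap (ψ.toSymHom.app n).toLin := by
  refine Submodule.span_le.2 ?_
  rintro _ ⟨r, k, σ, a, e, p, y, hr, hp, hy, rfl⟩
  change ψ.toSymHom.app n (R.map σ _) ∈ R'.decomposables n
  rw [ψ.toSymHom.naturality]
  have h : ψ.toSymHom.app _ (R.act.comp k p y) =
      R'.act.comp k (φ.app r p) (fun i => ψ.toSymHom.app (k i) (y i)) := ψ.map_act k p y
  rw [h]
  exact mem_decomposables (R := R') σ hr ((φ.app r).map_mem _ _ hp)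
    (fun i => (ψ.toSymHom.app _).map_mem _ _ (hy i))

/-- The morphism `ψ̄ : R̄ → R̄'` of indecomposable quotients induced by a morphism of left
`P`-modules `ψ : R → R'`, where `R'` is a left `P'`-module and `φ : P → P'`. -/
def Hom.indecomposablesMap {R : LeftModule P} {R' : LeftModule P'} {φ : Operad.Hom P P'}
    (ψ : Hom R (R'.restrict φ)) : SymMod.Hom R.indecomposables R'.indecomposables where
  app n := indecomposablesDesc R R' (ψ.toSymHom.app n) (hom_decomposables ψ n)
  naturality {m n} e x := by
    obtain ⟨x, rfl⟩ := Submodule.mkQ_surjective (R.decomposables m) x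
    exact congrArg (R'.decomposables n).mkQ (ψ.toSymHom.naturality e x)

end LeftModule

/-! ### The composition product -/

/-- The parts `J_i = f⁻¹(i)` of the ordered partition `J_1 ⊔ ⋯ ⊔ J_r = {1, …, n}` encoded by a map
`f`. -/
def part {n r : ℕ} (f : Fin n → Fin r) (i : Fin r) : Finset (Fin n) := {a | f a = i}

/-- The bijection which maps the `i`-th block increasingly onto the part `J_i`. -/
def shuffle {n r : ℕ} (f : Fin n → Fin r) : Fin (∑ i, (part f i).card) ≃ Fin n :=
  finSigmaFinEquiv.symm.trans ((Equiv.sigmaCongrRight fun i =>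
    ((part f i).orderIsoOfFin rfl).toEquiv.trans
      (Equiv.subtypeEquivRight (q := fun a => f a = i) (by simp [part]))).trans
    (Equiv.sigmaFiberEquiv f))

theorem part_comp {n r : ℕ} (w : Equiv.Perm (Fin r)) (f : Fin n → Fin r) (i : Fin r) :
    part (w ∘ f) (w i) = part f i := by
  ext; simp [part]

/-- The sum of the `M(r) ⊗ N(J_1) ⊗ ⋯ ⊗ N(J_r)` over all `r` and all ordered partitions
`J_1 ⊔ ⋯ ⊔ J_r = {1, …, n}`, where `N(J)` is identified with `N(|J|)` by the increasing bijection
`{1, …, |J|} ≃ J`. -/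
abbrev PreComposite (M N : SymMod.{u, v} K) (n : ℕ) : Type (max u v) :=
  ⨁ x : (Σ r : ℕ, (Fin n → Fin r)),
    (M x.1 ⊗[K] (⨂[K] i : Fin x.1, (N (part x.2 i).card : Type v)))

/-- The summand of index `(J_1, …, J_r)`, where `J_i = f⁻¹(i)`. -/
noncomputable def PreComposite.of (M N : SymMod.{u, v} K) {n r : ℕ} (f : Fin n → Fin r) (p : M r)
    (y : ∀ i, N (part f i).card) : PreComposite M N n :=
  letI := Classical.decEq (Σ r : ℕ, (Fin n → Fin r))
  DirectSum.lof K (Σ r : ℕ, (Fin n → Fin r))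
    (fun x => M x.1 ⊗[K] (⨂[K] i : Fin x.1, (N (part x.2 i).card : Type v)))
    ⟨r, f⟩ (p ⊗ₜ[K] PiTensorProduct.tprod K y)

/-- The relations `w_*(p) ⊗ (y_1 ⊗ ⋯ ⊗ y_r) ≡ ± p ⊗ (y_{w(1)} ⊗ ⋯ ⊗ y_{w(r)})`, `w ∈ Σ_r`, which
define the coinvariants. -/
def compositeRelations (M N : SymMod.{u, v} K) (n : ℕ) : Submodule K (PreComposite M N n) :=
  Submodule.span K {z | ∃ (r : ℕ) (w : Equiv.Perm (Fin r)) (f : Fin n → Fin r) (p : M r)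
    (e : Fin r → ℕ) (y : ∀ i, N (part (w ∘ f) i).card), (∀ i, y i ∈ (N _).gr (e i)) ∧
    z = PreComposite.of M N (w ∘ f) (M.map w p) y -
      koszulSign K w e • PreComposite.of M N f p
        (fun i => N.map (finCongr (congrArg Finset.card (part_comp w f i))) (y (w i)))}

/-- The composition product
`(M ∘ N)(n) = ⨁_r (⨁_{(J_1, …, J_r)} M(r) ⊗ N(J_1) ⊗ ⋯ ⊗ N(J_r))_{Σ_r}`. -/
abbrev Composite (M N : SymMod.{u, v} K) (n : ℕ) : Type (max u v) :=
  PreComposite M N n ⧸ compositeRelations M N n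

section canonical

variable {P : Operad.{u, v} K} (R : LeftModule P) (N : SymMod.{u, v} K)
  (ι : ∀ n, N n →ₗ[K] R.obj n)

/-- The map `p ⊗ (y_1 ⊗ ⋯ ⊗ y_r) ↦ p(ι y_1, …, ι y_r)`, where the entries of the composite are
relabelled by the partition. -/
noncomputable def preCanonical (n : ℕ) : PreComposite P.toSymMod N n →ₗ[K] R.obj n :=
  letI := Classical.decEq (Σ r : ℕ, (Fin n → Fin r))
  DirectSum.toModule K _ _ fun x => TensorProduct.lift
    { toFun := fun p => (R.map (shuffle x.2)).toLin ∘ₗ PiTensorProduct.lift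
        ((R.act.comp (fun i => (part x.2 i).card) p).compLinearMap (fun i => ι _))
      map_add' := fun p q => by
        ext y; simp
      map_smul' := fun c p => by
        ext y; simp }

theorem preCanonical_of {n r : ℕ} (f : Fin n → Fin r) (p : P.obj r)
    (y : ∀ i, N (part f i).card) :
    preCanonical R N ι n (PreComposite.of P.toSymMod N f p y) =
      R.map (shuffle f) (R.act.comp _ p (fun i => ι _ (y i))) := by
  classical
  unfold preCanonical PreComposite.of
  simp

theorem shuffle_comp {n r : ℕ} (w : Equiv.Perm (Fin r)) (f : Fin n → Fin r) :
    (blockEquiv w (fun j => (part (w ∘ f) j).card)).trans (shuffle (w ∘ f)) =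
      (sumEquiv fun i => finCongr (congrArg Finset.card (part_comp w f i))).trans (shuffle f) := by
  ext x
  obtain ⟨⟨i, a⟩, rfl⟩ := finSigmaFinEquiv.surjective x
  have key : ∀ (s t : Finset (Fin n)) (h : s = t) (a : Fin s.card),
      s.orderEmbOfFin rfl a = t.orderEmbOfFin rfl (Fin.cast (congrArg Finset.card h) a) := by
    rintro s _ rfl a; rfl
  have h := key _ _ (part_comp w f i)
  simp [blockEquiv, sumEquiv, shuffle, Equiv.sigmaFiberEquiv]
  exact congrArg Fin.val (h a)

/-- The canonical map `P ∘ N → R`, `p(y_1, …, y_r) ↦ p(ι y_1, …, ι y_r)`, which extends a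
homogeneous and equivariant map `ι : N → R` to a morphism of (graded) left `P`-modules. -/
noncomputable def canonical (hgr : ∀ n k x, x ∈ (N n).gr k → ι n x ∈ (R.obj n).gr k)
    (hmap : ∀ {m n : ℕ} (e : Fin m ≃ Fin n) (x : N m), ι n (N.map e x) = R.map e (ι m x))
    (n : ℕ) : Composite P.toSymMod N n →ₗ[K] R.obj n :=
  (compositeRelations P.toSymMod N n).liftQ (preCanonical R N ι n) (by
    refine Submodule.span_le.2 ?_
    rintro _ ⟨r, w, f, p, e, y, hy, rfl⟩
    rw [SetLike.mem_coe, LinearMap.mem_ker, map_sub, map_smul, preCanonical_of, preCanonical_of,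
      sub_eq_zero]
    have h1 := R.act.comp_map_outer w _ e p (fun i => ι _ (y i)) (fun i => hgr _ _ _ (hy i))
    have h2 := R.act.comp_map_inner _ _
      (fun i => finCongr (congrArg Finset.card (part_comp w f i))) p (fun i => ι _ (y (w i)))
    simp only [hmap]
    rw [h1, h2, map_smul, ← R.map_trans, ← R.map_trans, shuffle_comp])

end canonical

/-- A left `P`-module `R` is quasi-free if `R = P ∘ N` for a dg-`Σ_*`-module `N`, with a
differential `δ + d_θ` where the composite `N ⊂ P ∘ N → P ∘ N → N` of `d_θ` with the canonical
projection vanishes.  Here the inclusion `ι : N → R` is homogeneous and equivariant but need not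
commute with differentials; the canonical map `P ∘ N → R` is an isomorphism; and, on generators,
`d_θ(y)` is the difference of the differential of `ι y` in `R` and of the image of the differential
of `y` in `N`, which is required to be decomposable.  (By the derivation relation `d_θ` is determined
by its restriction to `N`.) -/
structure QuasiFree {P : Operad.{u, v} K} (R : LeftModule P) where
  gen : SymMod.{u, v} K
  incl : ∀ n, gen n →ₗ[K] R.obj n
  incl_mem : ∀ n k x, x ∈ (gen n).gr k → incl n x ∈ (R.obj n).gr k
  incl_map : ∀ {m n : ℕ} (e : Fin m ≃ Fin n) (x : gen m),
    incl n (gen.map e x) = R.map e (incl m x)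
  bijective : ∀ n, Function.Bijective (canonical R gen incl incl_mem incl_map n)
  twist_mem : ∀ n (y : gen n),
    (R.obj n).d (incl n y) - incl n ((gen n).d y) ∈ R.decomposables n

end OperadicModules

open OperadicModules

/-! Filter R(n) by the arity of the outer operation: `QuasiFree.filt s n` is spanned by the
composites p(y_1, …, y_r) of generators with r ≥ s. Since P(0) = 0, the stages s = 0 and s = 1 are
all of R(n). Stage 2 is the decomposable part (`filt_two`), so the quotient by it is the
indecomposable quotient. Since the generators vanish in arity 0, stage n + 1 is zero
(`filt_eq_bot`). The filtration is therefore finite in each arity, and no spectral sequence is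
needed: two-out-of-three for short exact sequences (`ExactStep`), applied to mapping cones, is
enough.

The graded piece of index s is the sum, over the partitions of {1, …, n} into s non-empty parts, of
P(s) ⊗ R̄(J_1) ⊗ ⋯ ⊗ R̄(J_s) with its untwisted differential (`QuasiFree.exactStep`). Two facts give
this. The symmetric group acts freely on surjections, so the coinvariants reduce to a choice of
ordering for each partition, over any ring K. The twist sends generators to decomposables, so it
raises the filtration. For the same reason ψ induces φ ⊗ ψ̄ ⊗ ⋯ ⊗ ψ̄ on the graded pieces
(`hom_blockMap`, `grProj_hom`).

The Künneth step (`Hom.IsQIso.tensor`) assumes nothing on P(s). A quasi-isomorphism stays one after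
tensoring with a flat dg-module, because its cone stays acyclic. A quasi-isomorphism of projective
dg-modules is a homotopy equivalence, so it stays one after tensoring with anything.

For (a), the pieces with s ≥ 2 are compared by Künneth, hence so is stage 2, and the quotient by
stage 2 is compared by ψ̄. For (b), induct on n: with s ≥ 2 parts every part has size less than n,
so stage 2 in arity n involves only ψ̄ in lower arities, and ψ̄(n) follows from the quotient. For
(c), induct on n: stage 2 is compared by hypothesis, and the pieces 2 ≤ s < n involve only φ(s) with
s < n. What remains is stage n, whose single block is P(n) ⊗ R̄(1)^{⊗n}; cancelling the rank-one
factors leaves φ(n). -/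

namespace OperadicModules

variable {K : Type u} [CommRing K]

/-! ### Mapping cones and quasi-isomorphisms -/

section Cones

variable {A B C : Type*} [AddCommGroup A] [Module K A] [AddCommGroup B] [Module K B]
  [AddCommGroup C] [Module K C]

/-- Every cycle of the submodule `G` is the boundary of an element of `G`. -/
def AcyclicOn (d : A →ₗ[K] A) (G : Submodule K A) : Prop :=
  ∀ x ∈ G, d x = 0 → ∃ y ∈ G, x = d y

/-- The differential of the mapping cone of `f : A → B`. -/
def coneD (dA : A →ₗ[K] A) (dB : B →ₗ[K] B) (f : A →ₗ[K] B) : (B × A) →ₗ[K] (B × A) :=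
  (dB.coprod f).prod (-(dA ∘ₗ LinearMap.snd K B A))

@[simp] theorem coneD_apply (dA : A →ₗ[K] A) (dB : B →ₗ[K] B) (f : A →ₗ[K] B) (z : B × A) :
    coneD dA dB f z = (dB z.1 + f z.2, -dA z.2) := rfl

/-- The restriction of `f` to the submodules `G → G'` is a quasi-isomorphism, in the sense that
its mapping cone is acyclic. -/
def QIsoOn (dA : A →ₗ[K] A) (dB : B →ₗ[K] B) (f : A →ₗ[K] B) (G : Submodule K A)
    (G' : Submodule K B) : Prop :=
  AcyclicOn (coneD dA dB f) (G'.prod G)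

/-- `f` is a quasi-isomorphism, in the sense that its mapping cone is acyclic. -/
abbrev QIso (dA : A →ₗ[K] A) (dB : B →ₗ[K] B) (f : A →ₗ[K] B) : Prop :=
  QIsoOn dA dB f ⊤ ⊤

/-- A cycle of the cone is a pair (-y, x) with x a cycle and f x = dB y. Taking x = 0 recovers
surjectivity in homology, and the condition on x recovers injectivity. -/
theorem qIsoOn_iff {dA : A →ₗ[K] A} {dB : B →ₗ[K] B} {f : A →ₗ[K] B} {G : Submodule K A}
    {G' : Submodule K B} :
    QIsoOn dA dB f G G' ↔ ∀ x ∈ G, ∀ y ∈ G', dA x = 0 → f x = dB y →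
      ∃ z ∈ G, ∃ w ∈ G', x = dA z ∧ y = f z + dB w := by
  constructor
  · intro h x hx y hy hdx hfx
    obtain ⟨⟨w, z⟩, hwz, he⟩ := h (-y, x) ⟨G'.neg_mem hy, hx⟩ (by simp [hdx, hfx])
    rw [coneD_apply, Prod.mk.injEq] at he
    refine ⟨-z, G.neg_mem hwz.2, -w, G'.neg_mem hwz.1, by simpa using he.2, ?_⟩
    rw [← neg_neg y, he.1]
    simp
  · rintro h ⟨y, x⟩ ⟨hy, hx⟩ he
    rw [coneD_apply, Prod.mk_eq_zero] at he
    obtain ⟨z, hz, w, hw, h1, h2⟩ := h x hx (-y) (G'.neg_mem hy) (by simpa using he.2)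
      (by rw [map_neg, eq_neg_iff_add_eq_zero, add_comm]; exact he.1)
    refine ⟨(-w, -z), ⟨G'.neg_mem hw, G.neg_mem hz⟩, ?_⟩
    rw [coneD_apply, Prod.mk.injEq]
    refine ⟨?_, by simpa using h1⟩
    rw [← neg_neg y, h2]
    simp

theorem qIso_iff {dA : A →ₗ[K] A} {dB : B →ₗ[K] B} {f : A →ₗ[K] B} :
    QIso dA dB f ↔ ∀ x y, dA x = 0 → f x = dB y → ∃ z w, x = dA z ∧ y = f z + dB w := by
  simp [qIsoOn_iff]

theorem QIsoOn.of_eq_bot {dA : A →ₗ[K] A} {dB : B →ₗ[K] B} {f : A →ₗ[K] B} {G : Submodule K A}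
    {G' : Submodule K B} (hG : G = ⊥) (hG' : G' = ⊥) : QIsoOn dA dB f G G' := by
  subst hG hG'
  rw [qIsoOn_iff]
  intro x hx y hy _ _
  rw [Submodule.mem_bot] at hx hy
  exact ⟨0, zero_mem _, 0, zero_mem _, by simp [hx], by simp [hy]⟩

/-- An exact sequence `0 → H → G → T → 0` of differential modules, where `H ≤ G` are submodules of
an ambient differential module `A`. -/
structure ExactStep (d : A →ₗ[K] A) (G H : Submodule K A) (dT : C →ₗ[K] C) (q : A →ₗ[K] C) :
    Prop where
  le : H ≤ G
  d_d : ∀ x ∈ G, d (d x) = 0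
  d_mem : ∀ x ∈ G, d x ∈ G
  d_mem' : ∀ x ∈ H, d x ∈ H
  map_d : ∀ x ∈ G, q (d x) = dT (q x)
  surj : ∀ t, ∃ x ∈ G, q x = t
  ker : ∀ x ∈ G, q x = 0 ↔ x ∈ H

namespace ExactStep

variable {d : A →ₗ[K] A} {G H : Submodule K A} {dT : C →ₗ[K] C} {q : A →ₗ[K] C}

/-- This and the next two lemmas are the two-out-of-three property usually read off the long exact
sequence, here by direct chases that need no grading. -/
theorem middle (h : ExactStep d G H dT q) (hH : AcyclicOn d H) (hT : AcyclicOn dT ⊤) :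
    AcyclicOn d G := by
  intro x hx hdx
  obtain ⟨t, -, ht⟩ := hT (q x) trivial (by rw [← h.map_d x hx, hdx, map_zero])
  obtain ⟨y, hy, rfl⟩ := h.surj t
  have hmem : x - d y ∈ H := by
    rw [← h.ker _ (sub_mem hx (h.d_mem y hy)), map_sub, ht, h.map_d y hy, sub_self]
  obtain ⟨z, hz, hxz⟩ := hH _ hmem (by rw [map_sub, hdx, h.d_d y hy, sub_self])
  exact ⟨z + y, add_mem (h.le hz) hy, by rw [map_add, ← hxz, sub_add_cancel]⟩

theorem right (h : ExactStep d G H dT q) (hH : AcyclicOn d H) (hG : AcyclicOn d G) :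
    AcyclicOn dT ⊤ := by
  rintro t - ht
  obtain ⟨x, hx, rfl⟩ := h.surj t
  have hmem : d x ∈ H := by rw [← h.ker _ (h.d_mem x hx), h.map_d x hx, ht]
  obtain ⟨y, hy, hxy⟩ := hH _ hmem (h.d_d x hx)
  obtain ⟨z, hz, hz'⟩ := hG (x - y) (sub_mem hx (h.le hy)) (by rw [map_sub, hxy, sub_self])
  refine ⟨q z, trivial, ?_⟩
  rw [← h.map_d z hz, ← hz', map_sub, (h.ker y (h.le hy)).2 hy, sub_zero]

theorem left (h : ExactStep d G H dT q) (hG : AcyclicOn d G) (hT : AcyclicOn dT ⊤) :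
    AcyclicOn d H := by
  intro x hx hdx
  obtain ⟨y, hy, rfl⟩ := hG x (h.le hx) hdx
  obtain ⟨t, -, ht⟩ := hT (q y) trivial (by rw [← h.map_d y hy, (h.ker _ (h.le hx)).2 hx])
  obtain ⟨z, hz, rfl⟩ := h.surj t
  refine ⟨y - d z, ?_, by rw [map_sub, h.d_d z hz, sub_zero]⟩
  rw [← h.ker _ (sub_mem hy (h.d_mem z hz)), map_sub, ht, h.map_d z hz, sub_self]

variable {A' C' : Type*} [AddCommGroup A'] [Module K A'] [AddCommGroup C'] [Module K C']
  {d' : A' →ₗ[K] A'} {G' H' : Submodule K A'} {dT' : C' →ₗ[K] C'} {q' : A' →ₗ[K] C'}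

/-- Cones of a morphism of exact sequences form an exact sequence, so two-out-of-three for
quasi-isomorphisms reduces to two-out-of-three for acyclicity. -/
theorem cone (h : ExactStep d G H dT q) (h' : ExactStep d' G' H' dT' q') {f : A →ₗ[K] A'}
    {g : C →ₗ[K] C'} (hf : ∀ x, f (d x) = d' (f x)) (hG : ∀ x ∈ G, f x ∈ G')
    (hH : ∀ x ∈ H, f x ∈ H') (hg : ∀ x ∈ G, q' (f x) = g (q x)) :
    ExactStep (coneD d d' f) (G'.prod G) (H'.prod H) (coneD dT dT' g) (q'.prodMap q) where
  le := Submodule.prod_mono h'.le h.le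
  d_d := by
    rintro ⟨y, x⟩ ⟨hy, hx⟩
    simp [h.d_d x hx, h'.d_d y hy, hf]
  d_mem := by
    rintro ⟨y, x⟩ ⟨hy, hx⟩
    exact ⟨add_mem (h'.d_mem y hy) (hG x hx), neg_mem (h.d_mem x hx)⟩
  d_mem' := by
    rintro ⟨y, x⟩ ⟨hy, hx⟩
    exact ⟨add_mem (h'.d_mem' y hy) (hH x hx), neg_mem (h.d_mem' x hx)⟩
  map_d := by
    rintro ⟨y, x⟩ ⟨hy, hx⟩
    simp [h.map_d x hx, h'.map_d y hy, hg x hx]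
  surj := by
    rintro ⟨t', t⟩
    obtain ⟨x, hx, rfl⟩ := h.surj t
    obtain ⟨y, hy, rfl⟩ := h'.surj t'
    exact ⟨(y, x), ⟨hy, hx⟩, rfl⟩
  ker := by
    rintro ⟨y, x⟩ ⟨hy, hx⟩
    simp [← h.ker x hx, ← h'.ker y hy]

end ExactStep

/-- A map with a homotopy inverse is a quasi-isomorphism. -/
theorem QIso.of_homotopy {dA : A →ₗ[K] A} {dB : B →ₗ[K] B} {f : A →ₗ[K] B} (h : B →ₗ[K] A)
    (s : B →ₗ[K] B) (t : A →ₗ[K] A) (hf : ∀ x, f (dA x) = dB (f x))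
    (hd : ∀ y, h (dB y) = dA (h y)) (hs : ∀ y, y = f (h y) + dB (s y) + s (dB y))
    (ht : ∀ x, h (f x) = x + dA (t x) + t (dA x)) : QIso dA dB f := by
  rw [qIso_iff]
  intro x y hx hy
  have h1 := ht x
  rw [hx, map_zero, add_zero, hy, hd] at h1
  have hz : x = dA (h y - t x) := by rw [map_sub, h1, add_sub_cancel_right]
  set z := h y - t x
  have h2 := hs (y - f z)
  have h3 : dB (y - f z) = 0 := by rw [map_sub, ← hy, ← hf, ← hz, sub_self]
  rw [h3, map_zero, add_zero] at h2
  refine ⟨z + h (y - f z), s (y - f z), ?_, ?_⟩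
  · rw [map_add, ← hd, h3, map_zero, add_zero, hz]
  · rw [map_add, add_assoc, ← h2, add_sub_cancel]

/-- Quasi-isomorphisms are invariant under isomorphisms of differential modules. -/
theorem QIso.congr {A' B' : Type*} [AddCommGroup A'] [Module K A'] [AddCommGroup B'] [Module K B']
    {dA : A →ₗ[K] A} {dB : B →ₗ[K] B} {f : A →ₗ[K] B} {dA' : A' →ₗ[K] A'} {dB' : B' →ₗ[K] B'}
    {f' : A' →ₗ[K] B'} (a : A ≃ₗ[K] A') (b : B ≃ₗ[K] B') (ha : ∀ x, a (dA x) = dA' (a x))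
    (hb : ∀ x, b (dB x) = dB' (b x)) (hf : ∀ x, b (f x) = f' (a x)) (h : QIso dA dB f) :
    QIso dA' dB' f' := by
  rw [qIso_iff] at h ⊢
  intro x y hx hy
  obtain ⟨x, rfl⟩ := a.surjective x
  obtain ⟨y, rfl⟩ := b.surjective y
  obtain ⟨z, w, rfl, rfl⟩ := h x y (a.injective (by rw [ha, hx, map_zero]))
    (b.injective (by rw [hf, hb, hy]))
  exact ⟨a z, b w, ha z, by rw [map_add, hf, hb]⟩

end Cones

/-- Injectivity in homology writes x as a boundary d z, and surjectivity then corrects the cycle y -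
f z. The converse tests the cone condition on x and y separately. -/
theorem DGMod.Hom.isQuasiIso_iff {V W : DGMod.{u, v} K} (f : DGMod.Hom V W) :
    f.IsQuasiIso ↔ QIso V.d W.d f.toLin := by
  have hz : ∀ (V : DGMod.{u, v} K) (x : LinearMap.ker V.d),
      (Submodule.Quotient.mk x : V.Homology) = 0 ↔ ∃ z, V.d z = x := by
    intro V x
    rw [Submodule.Quotient.mk_eq_zero]
    rfl
  have hm : ∀ x : LinearMap.ker V.d, f.homologyMap (Submodule.Quotient.mk x) =
      Submodule.Quotient.mk ⟨f x, by rw [LinearMap.mem_ker, ← f.map_d, x.2, map_zero]⟩ :=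
    fun x => rfl
  rw [qIso_iff]
  constructor
  · rintro ⟨hi, hs⟩ x y hx hy
    obtain ⟨z, hz'⟩ := (hz V ⟨x, hx⟩).1 (hi (by
      rw [map_zero, hm, hz]; exact ⟨y, hy.symm⟩))
    have hcyc : W.d (y - f z) = 0 := by
      rw [map_sub, ← f.map_d, hz']
      exact sub_eq_zero.2 hy.symm
    obtain ⟨t, ht⟩ := hs (Submodule.Quotient.mk ⟨y - f z, hcyc⟩)
    obtain ⟨t, rfl⟩ := Submodule.Quotient.mk_surjective _ t
    rw [hm, eq_comm, ← sub_eq_zero, ← Submodule.Quotient.mk_sub, hz] at ht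
    obtain ⟨w, hw⟩ := ht
    refine ⟨z + t, w, ?_, ?_⟩
    · rw [map_add, hz', t.2, add_zero]
    · rw [hw]
      simp
  · intro h
    constructor
    · rw [injective_iff_map_eq_zero]
      intro t ht
      obtain ⟨t, rfl⟩ := Submodule.Quotient.mk_surjective _ t
      rw [hm, hz] at ht
      obtain ⟨y, hy⟩ := ht
      obtain ⟨z, w, hz', -⟩ := h t y t.2 hy.symm
      rw [hz]
      exact ⟨z, hz'.symm⟩
    · intro t
      obtain ⟨t, rfl⟩ := Submodule.Quotient.mk_surjective _ t
      obtain ⟨z, w, h1, h2⟩ := h 0 t (map_zero _) (by rw [map_zero]; exact t.2.symm)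
      refine ⟨Submodule.Quotient.mk ⟨z, h1.symm⟩, ?_⟩
      rw [hm, eq_comm, ← sub_eq_zero, ← Submodule.Quotient.mk_sub, hz]
      refine ⟨w, ?_⟩
      simp [h2]

/-! ### Operators on graded modules -/

namespace DGMod

variable (V : DGMod.{u, v} K)

/-- The decomposition `V = ⨁ V_k`. -/
noncomputable def decompEquiv : (⨁ k, V.gr k) ≃ₗ[K] V :=
  LinearEquiv.ofBijective (DirectSum.coeLinearMap V.gr) V.isInternal

/-- The operator which multiplies the elements of degree `k` by `c k`. -/
noncomputable def weight (c : ℕ → K) : V →ₗ[K] V :=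
  DirectSum.toModule K ℕ V (fun k => c k • (V.gr k).subtype) ∘ₗ V.decompEquiv.symm.toLinearMap

variable {V}

theorem weight_of_mem {c : ℕ → K} {k : ℕ} {x : V} (hx : x ∈ V.gr k) :
    V.weight c x = c k • x := by
  have h : V.decompEquiv.symm x = DirectSum.lof K ℕ (fun k => V.gr k) k ⟨x, hx⟩ := by
    rw [LinearEquiv.symm_apply_eq]
    exact (DirectSum.coeLinearMap_lof V.gr k ⟨x, hx⟩).symm
  rw [weight, LinearMap.comp_apply, LinearEquiv.coe_coe, h, DirectSum.toModule_lof]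
  simp

theorem hom_induction {p : V → Prop} (zero : p 0) (hom : ∀ k, ∀ x ∈ V.gr k, p x)
    (add : ∀ x y, p x → p y → p (x + y)) (x : V) : p x := by
  have hx : x ∈ ⨆ k, V.gr k := by rw [V.isInternal.submodule_iSup_eq_top]; trivial
  exact Submodule.iSup_induction V.gr (motive := p) hx hom zero add

theorem span_homogeneous (V : DGMod.{u, v} K) :
    Submodule.span K {x : V | ∃ k, x ∈ V.gr k} = ⊤ := by
  rw [eq_top_iff]
  rintro x -
  induction x using hom_induction with
  | zero => exact zero_mem _
  | hom k x hx => exact Submodule.subset_span ⟨k, hx⟩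
  | add x y hx hy => exact add_mem hx hy

variable (V)

/-- The sign operator `x ↦ (-1)^k x` on `V_k`. -/
noncomputable def sgn : V →ₗ[K] V := V.weight fun k => (-1) ^ k

/-- The projection onto the component of degree `k`. -/
noncomputable def proj (k : ℕ) : V →ₗ[K] V := V.weight fun l => if l = k then 1 else 0

variable {V}

theorem sgn_of_mem {k : ℕ} {x : V} (hx : x ∈ V.gr k) : V.sgn x = (-1 : K) ^ k • x :=
  weight_of_mem hx

theorem proj_of_mem {k : ℕ} (l : ℕ) {x : V} (hx : x ∈ V.gr k) :
    V.proj l x = if k = l then x else 0 := by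
  rw [proj, weight_of_mem hx]; split_ifs <;> simp

theorem sgn_sgn (x : V) : V.sgn (V.sgn x) = x := by
  induction x using hom_induction with
  | zero => simp
  | hom k x hx => rw [sgn_of_mem hx, map_smul, sgn_of_mem hx, smul_smul, ← mul_pow]; simp
  | add x y hx hy => simp [hx, hy]

theorem sgn_d (x : V) : V.sgn (V.d x) = -V.d (V.sgn x) := by
  induction x using hom_induction with
  | zero => simp
  | hom k x hx =>
    rw [sgn_of_mem hx, map_smul]
    cases k with
    | zero => simp [V.d_zero x hx]
    | succ k => rw [sgn_of_mem (V.d_mem k x hx), pow_succ]; simp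
  | add x y hx hy => simp only [map_add, hx, hy, neg_add]

theorem proj_d (k : ℕ) (x : V) : V.proj k (V.d x) = V.d (V.proj (k + 1) x) := by
  induction x using hom_induction with
  | zero => simp
  | hom l x hx =>
    rw [proj_of_mem _ hx]
    cases l with
    | zero => simp [V.d_zero x hx]
    | succ l => rw [proj_of_mem _ (V.d_mem l x hx)]; by_cases h : l = k <;> simp [h]
  | add x y hx hy => simp only [map_add, hx, hy]

theorem d_proj_zero (x : V) : V.d (V.proj 0 x) = 0 := by
  induction x using hom_induction with
  | zero => simp
  | hom l x hx =>
    rw [proj_of_mem _ hx]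
    split_ifs with h
    · subst h; exact V.d_zero x hx
    · simp
  | add x y hx hy => simp only [map_add, hx, hy, add_zero]

theorem proj_proj (k l : ℕ) (x : V) : V.proj k (V.proj l x) = if k = l then V.proj k x else 0 := by
  induction x using hom_induction with
  | zero => simp
  | hom j x hx =>
    simp only [proj_of_mem _ hx]
    by_cases h1 : j = l <;> by_cases h2 : k = l
    · subst h1 h2; simp [proj_of_mem _ hx]
    · subst h1; simp [proj_of_mem _ hx, h2, Ne.symm h2]
    · subst h2; simp [h1]
    · simp [h1, h2]
  | add x y hx hy => simp only [map_add, hx, hy]; split_ifs <;> simp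

theorem sum_proj (x : V) : ∃ N, ∀ M ≥ N, ∑ k ∈ Finset.range M, V.proj k x = x := by
  induction x using hom_induction with
  | zero => exact ⟨0, fun M _ => by simp⟩
  | hom l x hx =>
    refine ⟨l + 1, fun M hM => ?_⟩
    simp only [proj_of_mem _ hx, Finset.sum_ite_eq, Finset.mem_range]
    rw [if_pos (by omega)]
  | add x y hx hy =>
    obtain ⟨N, hN⟩ := hx
    obtain ⟨N', hN'⟩ := hy
    refine ⟨max N N', fun M hM => ?_⟩
    simp only [map_add, Finset.sum_add_distrib]
    rw [hN M (le_trans (le_max_left _ _) hM), hN' M (le_trans (le_max_right _ _) hM)]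

theorem Hom.map_sgn {V W : DGMod.{u, v} K} (f : Hom V W) (x : V) :
    f (V.sgn x) = W.sgn (f x) := by
  induction x using hom_induction with
  | zero => simp
  | hom k x hx => rw [sgn_of_mem hx, map_smul, sgn_of_mem (f.map_mem k x hx)]
  | add x y hx hy => simp only [map_add, hx, hy]

theorem Hom.map_proj {V W : DGMod.{u, v} K} (f : Hom V W) (k : ℕ) (x : V) :
    f (V.proj k x) = W.proj k (f x) := by
  induction x using hom_induction with
  | zero => simp
  | hom l x hx =>
    rw [proj_of_mem _ hx, proj_of_mem _ (f.map_mem l x hx)]; split_ifs <;> simp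
  | add x y hx hy => simp only [map_add, hx, hy]

end DGMod

/-! ### Differential modules with a sign operator -/

/-- A differential module with an involution which anticommutes with the differential. -/
structure SgnMod (K : Type u) [CommRing K] where
  carrier : Type v
  [addCommGroup : AddCommGroup carrier]
  [module : Module K carrier]
  d : carrier →ₗ[K] carrier
  sgn : carrier →ₗ[K] carrier
  d_d : ∀ x, d (d x) = 0
  sgn_sgn : ∀ x, sgn (sgn x) = x
  sgn_d : ∀ x, sgn (d x) = -d (sgn x)

namespace SgnMod

instance : CoeSort (SgnMod.{u, v} K) (Type v) := ⟨SgnMod.carrier⟩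

attribute [instance] SgnMod.addCommGroup SgnMod.module

/-- A morphism commutes with differentials and with sign operators. -/
structure Hom (A B : SgnMod.{u, v} K) where
  toLin : A →ₗ[K] B
  map_d : ∀ x, toLin (A.d x) = B.d (toLin x)
  map_sgn : ∀ x, toLin (A.sgn x) = B.sgn (toLin x)

instance (A B : SgnMod.{u, v} K) : CoeFun (Hom A B) (fun _ => A → B) := ⟨fun f => f.toLin⟩

/-- The morphism `f` is a quasi-isomorphism. -/
abbrev Hom.IsQIso {A B : SgnMod.{u, v} K} (f : Hom A B) : Prop := QIso A.d B.d f.toLin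

end SgnMod

/-- The differential module with sign operator underlying a dg-module. -/
noncomputable abbrev DGMod.toSgnMod (V : DGMod.{u, v} K) : SgnMod.{u, v} K where
  carrier := V
  d := V.d
  sgn := V.sgn
  d_d := V.d_d
  sgn_sgn := V.sgn_sgn
  sgn_d := V.sgn_d

noncomputable abbrev DGMod.Hom.toSgnHom {V W : DGMod.{u, v} K} (f : DGMod.Hom V W) :
    SgnMod.Hom V.toSgnMod W.toSgnMod where
  toLin := f.toLin
  map_d := f.map_d
  map_sgn := f.map_sgn

namespace SgnMod

/-- The tensor product, with the differential `d(a ⊗ b) = da ⊗ b ± a ⊗ db`. -/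
noncomputable abbrev tensor (A : SgnMod.{u, v} K) (B : DGMod.{u, v} K) : SgnMod.{u, v} K where
  carrier := A ⊗[K] B
  d := TensorProduct.map A.d LinearMap.id + TensorProduct.map A.sgn B.d
  sgn := TensorProduct.map A.sgn B.sgn
  d_d x := by
    induction x with
    | zero => simp
    | add x y hx hy => rw [map_add, map_add, hx, hy, add_zero]
    | tmul a b => simp [A.d_d, B.d_d, A.sgn_d, TensorProduct.neg_tmul]
  sgn_sgn x := by
    induction x with
    | zero => simp
    | add x y hx hy => rw [map_add, map_add, hx, hy]
    | tmul a b => simp [A.sgn_sgn, B.sgn_sgn]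
  sgn_d x := by
    induction x with
    | zero => simp
    | add x y hx hy => simp only [map_add, neg_add, hx, hy]
    | tmul a b => simp [A.sgn_d, B.sgn_d, TensorProduct.neg_tmul, TensorProduct.tmul_neg]; abel

variable {A A' : SgnMod.{u, v} K} {B B' : DGMod.{u, v} K}

/-- The tensor product of morphisms. -/
noncomputable abbrev Hom.tensor (f : Hom A A') (g : DGMod.Hom B B') :
    Hom (A.tensor B) (A'.tensor B') where
  toLin := TensorProduct.map f.toLin g.toLin
  map_d x := by
    induction x using TensorProduct.induction_on with
    | zero => simp
    | add x y hx hy => rw [map_add, map_add, map_add, map_add, hx, hy]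
    | tmul a b => simp [f.map_d, g.map_d, f.map_sgn]
  map_sgn x := by
    induction x using TensorProduct.induction_on with
    | zero => simp
    | add x y hx hy => rw [map_add, map_add, map_add, map_add, hx, hy]
    | tmul a b => simp [f.map_sgn, g.map_sgn]

end SgnMod

/-! ### The Künneth argument -/

/-- The tensor product of an acyclic module with a flat dg-module is acyclic. -/
theorem acyclicOn_tensor {C : SgnMod.{u, v} K} {B : DGMod.{u, v} K} [Module.Flat K B]
    (hC : AcyclicOn C.d ⊤) : AcyclicOn (C.tensor B).d ⊤ := by
  set p : ℕ → (C ⊗[K] B →ₗ[K] C ⊗[K] B) := fun k =>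
    TensorProduct.map LinearMap.id (B.proj k) with hp
  set d₁ : C ⊗[K] B →ₗ[K] C ⊗[K] B := TensorProduct.map C.d LinearMap.id with hd₁
  set d₂ : C ⊗[K] B →ₗ[K] C ⊗[K] B := TensorProduct.map C.sgn B.d with hd₂
  have hex : Function.Exact d₁ d₁ := by
    -- Flatness of B is used only here: the part C.d ⊗ id of the differential remains exact.
    refine Module.Flat.rTensor_exact B (f := C.d) (g := C.d) fun x => ⟨fun hx => ?_, ?_⟩
    · obtain ⟨y, -, rfl⟩ := hC x trivial hx
      exact ⟨y, rfl⟩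
    · rintro ⟨y, rfl⟩; exact C.d_d y
  have hp₁ : ∀ k x, p k (d₁ x) = d₁ (p k x) := fun k x => by
    rw [hp, hd₁, ← LinearMap.comp_apply, ← LinearMap.comp_apply]
    congr 1; ext; simp
  have hp₂ : ∀ k x, p k (d₂ x) = d₂ (p (k + 1) x) := fun k x => by
    rw [hp, hd₂, ← LinearMap.comp_apply, ← LinearMap.comp_apply]
    congr 1; ext; simp [DGMod.proj_d]
  have hpp : ∀ k l x, p k (p l x) = if k = l then p k x else 0 := fun k l x => by
    induction x with
    | zero => simp
    | add x y hx hy => simp only [map_add, hx, hy]; split_ifs <;> simp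
    | tmul a b => simp only [hp, TensorProduct.map_tmul, DGMod.proj_proj]; split_ifs <;> simp
  have hsum : ∀ x, ∃ N, ∀ M ≥ N, ∑ k ∈ Finset.range M, p k x = x := fun x => by
    induction x with
    | zero => exact ⟨0, by simp⟩
    | add x y hx hy =>
      obtain ⟨N, hN⟩ := hx
      obtain ⟨N', hN'⟩ := hy
      refine ⟨max N N', fun M hM => ?_⟩
      simp only [map_add, Finset.sum_add_distrib]
      rw [hN M (le_trans (le_max_left _ _) hM), hN' M (le_trans (le_max_right _ _) hM)]
    | tmul a b =>
      obtain ⟨N, hN⟩ := B.sum_proj b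
      refine ⟨N, fun M hM => ?_⟩
      simp only [hp, TensorProduct.map_tmul, LinearMap.id_apply]
      rw [← TensorProduct.tmul_sum, hN M hM]
  have hD : ∀ x, (C.tensor B).d x = d₁ x + d₂ x := fun x => rfl
  -- Induction on a bound for the degree in the factor B. As d₂ lowers this degree, the top
  -- component of a cycle is a d₁-cycle, hence a d₁-boundary. Subtracting the total boundary of a
  -- preimage cancels it and changes only lower components.
  have key : ∀ N x, (∀ k ≥ N, p k x = 0) → (C.tensor B).d x = 0 → ∃ y, x = (C.tensor B).d y := by
    intro N
    induction N with
    | zero =>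
      intro x hx _
      obtain ⟨N, hN⟩ := hsum x
      refine ⟨0, ?_⟩
      rw [map_zero, ← hN N le_rfl]
      exact Finset.sum_eq_zero fun k _ => hx k (Nat.zero_le k)
    | succ N ih =>
      intro x hx hdx
      have h1 : d₁ (p N x) = 0 := by
        have := congrArg (p N) hdx
        rwa [hD, map_add, hp₁, hp₂, hx (N + 1) le_rfl, map_zero, add_zero, map_zero] at this
      obtain ⟨z, hz⟩ := (hex _).1 h1
      -- The preimage z need not be homogeneous in B, so its component `p N z` is used instead.
      have hbd : ∀ k ≥ N, p k (x - (C.tensor B).d (p N z)) = 0 := by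
        intro k hk
        rw [hD, map_sub, map_add, hp₁, hp₂, hpp (k + 1), if_neg (by omega), map_zero, add_zero, hpp]
        rcases hk.eq_or_lt with h | h
        · rw [if_pos h.symm, ← h, ← hp₁, hz, hpp, if_pos rfl, sub_self]
        · rw [if_neg (by omega), map_zero, sub_zero, hx k h]
      obtain ⟨y, hy⟩ := ih _ hbd (by rw [map_sub, hdx, (C.tensor B).d_d, sub_zero])
      exact ⟨y + p N z, by rw [map_add, ← hy, sub_add_cancel]⟩
  rintro x - hx
  obtain ⟨N, hN⟩ := hsum x
  obtain ⟨y, hy⟩ := key N x (fun k hk => by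
    have h1 := hN (k + 1) (by omega)
    rw [Finset.sum_range_succ, hN k hk] at h1
    simpa using h1) hx
  exact ⟨y, trivial, hy⟩

namespace SgnMod

variable {A A' : SgnMod.{u, v} K} {B B' : DGMod.{u, v} K}

/-- The mapping cone. -/
abbrev cone (f : Hom A A') : SgnMod.{u, v} K where
  carrier := A' × A
  d := coneD A.d A'.d f.toLin
  sgn := A'.sgn.prodMap (-A.sgn)
  d_d := by rintro ⟨y, x⟩; simp [A.d_d, A'.d_d, f.map_d]
  sgn_sgn := by rintro ⟨y, x⟩; simp [A.sgn_sgn, A'.sgn_sgn]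
  sgn_d := by rintro ⟨y, x⟩; simp [A.sgn_d, A'.sgn_d, f.map_sgn]; abel

/-- The cone of f ⊗ B is the cone of f tensored with B, which is acyclic by `acyclicOn_tensor`. The
maps induced by `inl`, `inr`, `fst` and `snd` make the identification explicit. -/
theorem Hom.IsQIso.tensor_right {f : Hom A A'} (hf : f.IsQIso) (B : DGMod.{u, v} K)
    [Module.Flat K B] : QIso (A.tensor B).d (A'.tensor B).d (f.toLin.rTensor B) := by
  have hC : AcyclicOn (cone f).d ⊤ := by simpa [QIsoOn] using hf
  have hCB := acyclicOn_tensor (B := B) hC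
  have hl : ∀ y : A' ⊗[K] B, ((cone f).tensor B).d ((LinearMap.inl K A' A).rTensor B y) =
      (LinearMap.inl K A' A).rTensor B ((A'.tensor B).d y) := fun y => by
    induction y with
    | zero => simp
    | add x y hx hy => simp only [map_add, hx, hy]
    | tmul a b => simp
  have hr : ∀ x : A ⊗[K] B, ((cone f).tensor B).d ((LinearMap.inr K A' A).rTensor B x) =
      (LinearMap.inl K A' A).rTensor B (f.toLin.rTensor B x) -
      (LinearMap.inr K A' A).rTensor B ((A.tensor B).d x) := fun x => by
    induction x with
    | zero => simp
    | add x y hx hy => simp only [map_add, hx, hy]; abel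
    | tmul a b =>
      have h1 : (f.toLin a, -A.d a) = ((f.toLin a, 0) : A' × A) - (0, A.d a) := by simp
      have h2 : ((0 : A'), -A.sgn a) = - ((0 : A'), A.sgn a) := by simp
      simp only [LinearMap.rTensor_tmul, LinearMap.add_apply, TensorProduct.map_tmul, coneD_apply,
        LinearMap.inr_apply, LinearMap.inl_apply, map_zero, zero_add, LinearMap.prodMap_apply,
        LinearMap.neg_apply, LinearMap.id_apply, map_add]
      rw [h1, h2, TensorProduct.sub_tmul, TensorProduct.neg_tmul]
      abel
  have h11 : ∀ y : A' ⊗[K] B,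
      (LinearMap.fst K A' A).rTensor B ((LinearMap.inl K A' A).rTensor B y) = y := fun y => by
    rw [← LinearMap.rTensor_comp_apply, LinearMap.fst_comp_inl, LinearMap.rTensor_id_apply]
  have h12 : ∀ y : A ⊗[K] B,
      (LinearMap.fst K A' A).rTensor B ((LinearMap.inr K A' A).rTensor B y) = 0 := fun y => by
    rw [← LinearMap.rTensor_comp_apply, LinearMap.fst_comp_inr, LinearMap.rTensor_zero]; rfl
  have h21 : ∀ y : A' ⊗[K] B,
      (LinearMap.snd K A' A).rTensor B ((LinearMap.inl K A' A).rTensor B y) = 0 := fun y => by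
    rw [← LinearMap.rTensor_comp_apply, LinearMap.snd_comp_inl, LinearMap.rTensor_zero]; rfl
  have h22 : ∀ y : A ⊗[K] B,
      (LinearMap.snd K A' A).rTensor B ((LinearMap.inr K A' A).rTensor B y) = y := fun y => by
    rw [← LinearMap.rTensor_comp_apply, LinearMap.snd_comp_inr, LinearMap.rTensor_id_apply]
  have hdec : ∀ Y : (A' × A) ⊗[K] B, Y =
      (LinearMap.inl K A' A).rTensor B ((LinearMap.fst K A' A).rTensor B Y) +
      (LinearMap.inr K A' A).rTensor B ((LinearMap.snd K A' A).rTensor B Y) := fun Y => by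
    induction Y with
    | zero => simp
    | add x y hx hy =>
      simp only [map_add]
      nth_rewrite 1 [hx, hy]
      abel
    | tmul a b =>
      simp only [LinearMap.rTensor_tmul]
      rw [← TensorProduct.add_tmul]
      simp
  rw [qIso_iff]
  intro x y hx hy
  obtain ⟨Y, -, hY⟩ := hCB ((LinearMap.inl K A' A).rTensor B (-y) +
    (LinearMap.inr K A' A).rTensor B x) trivial (by
      rw [map_add, hl, hr, hx, hy, map_neg, map_neg, map_zero]; abel)
  rw [hdec Y, map_add, hl, hr] at hY
  have e1 := congrArg ((LinearMap.fst K A' A).rTensor B) hY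
  have e2 := congrArg ((LinearMap.snd K A' A).rTensor B) hY
  simp only [map_add, map_sub, h11, h12, h21, h22, add_zero, zero_add, sub_zero, zero_sub] at e1 e2
  refine ⟨-(LinearMap.snd K A' A).rTensor B Y, -(LinearMap.fst K A' A).rTensor B Y, ?_, ?_⟩
  · rw [map_neg, e2]
  · rw [map_neg, map_neg, ← neg_neg y, e1]; abel

end SgnMod

/-- A projective acyclic differential module which is graded by `ℕ` is contractible. -/
theorem exists_contraction {D : Type*} [AddCommGroup D] [Module K D] [Module.Projective K D]
    {d : D →ₗ[K] D} {p : ℕ → D →ₗ[K] D} (hdd : ∀ x, d (d x) = 0) (hd : AcyclicOn d ⊤)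
    (hpp : ∀ k x, p k (p k x) = p k x) (hpd : ∀ k x, p k (d x) = d (p (k + 1) x))
    (hp0 : ∀ x, d (p 0 x) = 0) (hsum : ∀ x, ∃ N, ∀ M ≥ N, ∑ k ∈ Finset.range M, p k x = x) :
    ∃ s : D →ₗ[K] D, ∀ x, d (s x) + s (d x) = x := by
  -- The hypothesis on e sits inside the conclusion, with default value 0, so that the chosen lift
  -- is a total function of e and can be used in a recursion.
  have hlift : ∀ e : D →ₗ[K] D, ∃ s : D →ₗ[K] D, (∀ x, d (e x) = 0) → ∀ x, d (s x) = e x := by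
    intro e
    by_cases he : ∀ x, d (e x) = 0
    · obtain ⟨s, hs⟩ := Module.projective_lifting_property
        (d.codRestrict (LinearMap.ker d) hdd) (e.codRestrict (LinearMap.ker d) he) (by
          rintro ⟨x, hx⟩
          obtain ⟨y, -, rfl⟩ := hd x trivial hx
          exact ⟨y, rfl⟩)
      exact ⟨s, fun _ x => congrArg Subtype.val (LinearMap.congr_fun hs x)⟩
    · exact ⟨0, fun h => absurd h he⟩
  choose L hL using hlift
  -- The contraction is built degree by degree: s_{k+1} lifts p_{k+1} - s_k d through d, which is
  -- possible because this map takes values in cycles.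
  let s : ℕ → D →ₗ[K] D := fun k => Nat.rec (L (p 0)) (fun k sk => L (p (k + 1) - sk ∘ₗ d)) k
  have hs0 : ∀ x, d (s 0 x) = p 0 x := hL (p 0) hp0
  have hsk : ∀ k x, d (s (k + 1) x) = p (k + 1) x - s k (d x) := by
    intro k
    induction k with
    | zero =>
      refine hL (p 1 - s 0 ∘ₗ d) fun x => ?_
      rw [LinearMap.sub_apply, map_sub, LinearMap.comp_apply, hs0, hpd, sub_self]
    | succ k ih =>
      refine hL (p (k + 2) - s (k + 1) ∘ₗ d) fun x => ?_
      rw [LinearMap.sub_apply, map_sub, LinearMap.comp_apply, ih, hdd, map_zero, sub_zero, hpd,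
        sub_self]
  have hfin : ∀ x, ∃ N, ∀ k ≥ N, p k x = 0 := fun x => by
    obtain ⟨N, hN⟩ := hsum x
    refine ⟨N, fun k hk => ?_⟩
    have h1 := hN (k + 1) (by omega)
    rw [Finset.sum_range_succ, hN k hk] at h1
    simpa using h1
  have hfs : ∀ x, (Function.support fun k => s k (p k x)).Finite := fun x => by
    obtain ⟨N, hN⟩ := hfin x
    refine (Set.finite_lt_nat N).subset fun k hk => ?_
    by_contra h
    exact hk (by simp [hN k (not_lt.1 h)])
  -- The sum of the s_k p_k has finitely many non-zero terms at each x, which makes `finsum` linear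
  -- here.
  let S : D →ₗ[K] D :=
    { toFun := fun x => ∑ᶠ k, s k (p k x)
      map_add' := fun x y => by
        rw [← finsum_add_distrib (hfs x) (hfs y)]
        simp
      map_smul' := fun c x => by
        simp only [map_smul, RingHom.id_apply]
        rw [smul_finsum' c (hfs x)] }
  have hS : ∀ x, ∃ N, ∀ M ≥ N, S x = ∑ k ∈ Finset.range M, s k (p k x) := fun x => by
    obtain ⟨N, hN⟩ := hfin x
    refine ⟨N, fun M hM => finsum_eq_sum_of_support_subset _ fun k hk => ?_⟩
    rw [Finset.coe_range, Set.mem_Iio]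
    by_contra h
    exact hk (by simp [hN k (hM.trans (not_lt.1 h))])
  refine ⟨S, fun x => ?_⟩
  obtain ⟨N₁, h₁⟩ := hS x
  obtain ⟨N₂, h₂⟩ := hS (d x)
  obtain ⟨N₃, h₃⟩ := hsum x
  set N := max N₁ (max N₂ N₃) with hN
  -- One more term is kept in S x than in S (d x), because p_k d = d p_{k+1} shifts the index by
  -- one.
  rw [h₁ (N + 1) (by omega), h₂ N (by omega), map_sum, Finset.sum_range_succ', hs0, hpp]
  simp only [hsk, hpp, hpd]
  rw [Finset.sum_sub_distrib]
  have := h₃ (N + 1) (by omega)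
  rw [Finset.sum_range_succ'] at this
  nth_rewrite 5 [← this]
  abel

/-- A quasi-isomorphism of projective dg-modules is a homotopy equivalence. -/
theorem DGMod.Hom.exists_homotopy_inverse {B B' : DGMod.{u, v} K} [Module.Projective K B]
    [Module.Projective K B'] {g : DGMod.Hom B B'} (hg : QIso B.d B'.d g.toLin) :
    ∃ (h : B' →ₗ[K] B) (s : B' →ₗ[K] B') (t : B →ₗ[K] B), (∀ y, h (B'.d y) = B.d (h y)) ∧
      (∀ y, y = g (h y) + B'.d (s y) + s (B'.d y)) ∧
      ∀ x, h (g x) = x + B.d (t x) + t (B.d x) := by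
  -- In the cone the source is shifted: its component of degree k is B'_k ⊕ B_{k-1}, with nothing
  -- from B when k = 0.
  let q : ℕ → B →ₗ[K] B := fun k => Nat.casesOn k 0 B.proj
  obtain ⟨S, hS⟩ := exists_contraction (D := B' × B) (d := coneD B.d B'.d g.toLin)
    (p := fun k => (B'.proj k).prodMap (q k))
    (by rintro ⟨y, x⟩; simp [B.d_d, B'.d_d, g.map_d])
    (by simpa [QIsoOn] using hg)
    (by rintro k ⟨y, x⟩; cases k <;> simp [q, proj_proj])
    (by
      rintro k ⟨y, x⟩
      cases k <;> simp [q, proj_d, d_proj_zero, g.map_proj])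
    (by rintro ⟨y, x⟩; simp [q, d_proj_zero])
    (by
      rintro ⟨y, x⟩
      obtain ⟨N, hN⟩ := B'.sum_proj y
      obtain ⟨N', hN'⟩ := B.sum_proj x
      refine ⟨max N (N' + 1), fun M hM => ?_⟩
      obtain ⟨M, rfl⟩ : ∃ M', M = M' + 1 := ⟨M - 1, by omega⟩
      ext
      · rw [Prod.fst_sum]
        exact hN _ (by omega)
      · rw [Prod.snd_sum, Finset.sum_range_succ']
        simpa [q] using hN' M (by omega))
  -- The matrix entries of the contraction of the cone are the homotopy inverse and the two
  -- homotopies.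
  refine ⟨LinearMap.snd K _ _ ∘ₗ S ∘ₗ LinearMap.inl K _ _,
    LinearMap.fst K _ _ ∘ₗ S ∘ₗ LinearMap.inl K _ _,
    LinearMap.snd K _ _ ∘ₗ S ∘ₗ LinearMap.inr K _ _, fun y => ?_, fun y => ?_, fun x => ?_⟩
  · have := congrArg Prod.snd (hS (y, 0))
    simp at this
    simp
    rwa [neg_add_eq_zero, eq_comm] at this
  · have := congrArg Prod.fst (hS (y, 0))
    simp at this
    simp
    nth_rewrite 1 [← this]
    abel
  · have := congrArg Prod.snd (hS (0, x))
    have h2 : S (g x, -B.d x) = S (g x, 0) - S (0, B.d x) := by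
      rw [← map_sub]; simp
    simp [h2] at this
    simp
    nth_rewrite 2 [← this]
    abel

theorem QIso.comp {A B C : Type*} [AddCommGroup A] [Module K A] [AddCommGroup B] [Module K B]
    [AddCommGroup C] [Module K C] {dA : A →ₗ[K] A} {dB : B →ₗ[K] B} {dC : C →ₗ[K] C}
    {g : B →ₗ[K] C} {f : A →ₗ[K] B} (hf : ∀ x, f (dA x) = dB (f x))
    (hg : ∀ x, g (dB x) = dC (g x)) (h₂ : QIso dB dC g) (h₁ : QIso dA dB f) :
    QIso dA dC (g ∘ₗ f) := by
  rw [qIso_iff] at *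
  intro x y hx hy
  obtain ⟨z, w, h3, rfl⟩ := h₂ (f x) y (by rw [← hf, hx, map_zero]) hy
  obtain ⟨z', w', rfl, rfl⟩ := h₁ x z hx h3
  exact ⟨z', g w' + w, rfl, by simp [hg]; abel⟩

namespace SgnMod

variable {A A' : SgnMod.{u, v} K} {B B' : DGMod.{u, v} K}

/-- Factor f ⊗ g as (A' ⊗ g) ∘ (f ⊗ B). The second factor is handled by flatness of B, the first by
a homotopy inverse of g, so neither A nor A' has to be flat. -/
theorem Hom.IsQIso.tensor [Module.Projective K B] [Module.Projective K B'] {f : Hom A A'}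
    {g : DGMod.Hom B B'} (hf : f.IsQIso) (hg : g.toSgnHom.IsQIso) : (f.tensor g).IsQIso := by
  have h1 := hf.tensor_right B
  obtain ⟨h, s, t, hd, hs, ht⟩ := DGMod.Hom.exists_homotopy_inverse hg
  have h2 : QIso (A'.tensor B).d (A'.tensor B').d (g.toLin.lTensor A') := by
    -- Inserting the sign operator of A' in the homotopies makes the cross terms with the
    -- differential of A' cancel.
    refine QIso.of_homotopy (h.lTensor A') (TensorProduct.map A'.sgn s)
      (TensorProduct.map A'.sgn t) (fun x => ?_) (fun x => ?_) (fun x => ?_) (fun x => ?_)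
    · induction x using TensorProduct.induction_on with
      | zero => simp
      | add x y hx hy => simp only [map_add, hx, hy]
      | tmul a b => simp [g.map_d]
    · induction x using TensorProduct.induction_on with
      | zero => simp
      | add x y hx hy => simp only [map_add, hx, hy]
      | tmul a b => simp [hd]
    · induction x using TensorProduct.induction_on with
      | zero => simp
      | add x y hx hy =>
        simp only [map_add]
        nth_rewrite 1 [hx, hy]
        abel
      | tmul a b =>
        nth_rewrite 1 [hs b]
        simp [A'.sgn_sgn, A'.sgn_d, TensorProduct.tmul_add, TensorProduct.neg_tmul]
        abel
    · induction x using TensorProduct.induction_on with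
      | zero => simp
      | add x y hx hy => simp only [map_add, hx, hy]; abel
      | tmul a b =>
        simp [ht, A'.sgn_sgn, A'.sgn_d, TensorProduct.tmul_add, TensorProduct.neg_tmul]
        abel
  have h3 := QIso.comp (fun x => ?_) (fun x => ?_) h2 h1
  · rwa [LinearMap.lTensor_comp_rTensor] at h3
  · induction x using TensorProduct.induction_on with
    | zero => simp
    | add x y hx hy => simp only [map_add, hx, hy]
    | tmul a b => simp [f.map_d, f.map_sgn]
  · induction x using TensorProduct.induction_on with
    | zero => simp
    | add x y hx hy => simp only [map_add, hx, hy]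
    | tmul a b => simp [g.map_d]

/-- The converse, for tensor products with dg-modules which are free of rank one and concentrated
in degree `0`. -/
theorem Hom.IsQIso.of_tensor_groundRing {f : Hom A A'} {g : DGMod.Hom B B'}
    (hB : B.IsGroundRing) (hB' : B'.IsGroundRing) (hg : g.toSgnHom.IsQIso)
    (h : (f.tensor g).IsQIso) : f.IsQIso := by
  have hd : ∀ V : DGMod.{u, v} K, V.IsGroundRing → ∀ x, V.d x = 0 := by
    rintro V ⟨b, hb, hV⟩ x
    obtain ⟨c, rfl⟩ := hV.2 x
    simp [V.d_zero b hb]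
  -- The differentials of B and B' vanish, so a quasi-isomorphism between them is bijective; f ⊗ g
  -- is then f up to isomorphisms.
  have hgb : Function.Bijective g.toLin := by
    rw [Hom.IsQIso, qIso_iff] at hg
    constructor
    · rw [injective_iff_map_eq_zero]
      intro x hx
      obtain ⟨z, -, rfl, -⟩ := hg x 0 (hd B hB x) (by rw [map_zero]; exact hx)
      exact hd B hB z
    · intro y
      obtain ⟨z, w, -, rfl⟩ := hg 0 y (map_zero _) (by rw [map_zero]; exact (hd B' hB' y).symm)
      exact ⟨z, by rw [show B'.toSgnMod.d w = 0 from hd B' hB' w, add_zero]⟩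
  obtain ⟨b, hb, hbB⟩ := hB
  let e : K ≃ₗ[K] B := LinearEquiv.ofBijective (LinearMap.toSpanSingleton K B b) hbB
  let e' : K ≃ₗ[K] B' := e.trans (LinearEquiv.ofBijective g.toLin hgb)
  let a : A ≃ₗ[K] A ⊗[K] B := (TensorProduct.rid K A).symm.trans (e.lTensor A)
  let a' : A' ≃ₗ[K] A' ⊗[K] B' := (TensorProduct.rid K A').symm.trans (e'.lTensor A')
  have he : e 1 = b := one_smul K b
  have he' : e' 1 = g b := congrArg g.toLin he
  have ha : ∀ x, a x = x ⊗ₜ b := fun x => by simp [a, he]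
  have ha' : ∀ x, a' x = x ⊗ₜ g b := fun x => by simp [a', he']
  refine QIso.congr a.symm a'.symm (fun x => ?_) (fun x => ?_) (fun x => ?_) h
  · obtain ⟨x, rfl⟩ := a.surjective x
    rw [LinearEquiv.symm_apply_eq, LinearEquiv.symm_apply_apply, ha, ha]
    simp [B.d_zero b hb]
  · obtain ⟨x, rfl⟩ := a'.surjective x
    rw [LinearEquiv.symm_apply_eq, LinearEquiv.symm_apply_apply, ha', ha']
    simp [B'.d_zero _ (g.map_mem 0 b hb)]
  · obtain ⟨x, rfl⟩ := a.surjective x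
    rw [LinearEquiv.symm_apply_eq, LinearEquiv.symm_apply_apply, ha, ha']
    simp

end SgnMod

/-! ### Iterated tensor products -/

namespace SgnMod

/-- The tensor product `A ⊗ B_1 ⊗ ⋯ ⊗ B_s`. -/
noncomputable def iter : (s : ℕ) → SgnMod.{u, v} K → (Fin s → DGMod.{u, v} K) → SgnMod.{u, v} K
  | 0, A, _ => A
  | s + 1, A, B => iter s (A.tensor (B 0)) (fun i => B i.succ)

/-- The elements `a ⊗ b_1 ⊗ ⋯ ⊗ b_s`. -/
noncomputable def pure : (s : ℕ) → (A : SgnMod.{u, v} K) → (B : Fin s → DGMod.{u, v} K) →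
    A →ₗ[K] MultilinearMap K (fun i => (B i : Type v)) (iter s A B)
  | 0, A, _ =>
    { toFun := fun a => MultilinearMap.constOfIsEmpty K _ (a : A)
      map_add' := fun _ _ => rfl
      map_smul' := fun _ _ => rfl }
  | s + 1, A, B =>
    { toFun := fun a => LinearMap.uncurryLeft (M := fun i => (B i : Type v))
        ((pure s (A.tensor (B 0)) fun i => B i.succ) ∘ₗ TensorProduct.mk K A (B 0) a)
      map_add' := fun a a' => by
        ext b
        change pure s (A.tensor (B 0)) _ ((a + a') ⊗ₜ[K] b 0 : A ⊗[K] B 0) _ = _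
        rw [TensorProduct.add_tmul, map_add]
        rfl
      map_smul' := fun c a => by
        ext b
        change pure s (A.tensor (B 0)) _ ((c • a) ⊗ₜ[K] b 0 : A ⊗[K] B 0) _ = _
        rw [← TensorProduct.smul_tmul', map_smul]
        rfl }

theorem pure_succ {s : ℕ} (A : SgnMod.{u, v} K) (B : Fin (s + 1) → DGMod.{u, v} K) (a : A)
    (b : ∀ i, B i) : pure (s + 1) A B a b =
      pure s (A.tensor (B 0)) (fun i => B i.succ) (a ⊗ₜ[K] b 0 : A ⊗[K] B 0) (fun i => b i.succ) :=
  rfl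

/-- The linear map on the iterated tensor product which is determined by a multilinear map. -/
noncomputable def iterLift {W : Type*} [AddCommGroup W] [Module K W] :
    (s : ℕ) → (A : SgnMod.{u, v} K) → (B : Fin s → DGMod.{u, v} K) →
    (A →ₗ[K] MultilinearMap K (fun i => (B i : Type v)) W) → (iter s A B →ₗ[K] W)
  | 0, A, _, Φ =>
    ({ toFun := fun a => Φ a (fun i => i.elim0)
       map_add' := fun a a' => by rw [Φ.map_add]; rfl
       map_smul' := fun c a => by rw [Φ.map_smul]; rfl } : A →ₗ[K] W)
  | s + 1, A, B, Φ => iterLift s (A.tensor (B 0)) (fun i => B i.succ) (TensorProduct.lift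
      { toFun := fun a => (Φ a).curryLeft
        map_add' := fun a a' => by ext; simp
        map_smul' := fun c a => by ext; simp })

theorem iterLift_pure {W : Type*} [AddCommGroup W] [Module K W] {s : ℕ} (A : SgnMod.{u, v} K)
    (B : Fin s → DGMod.{u, v} K) (Φ : A →ₗ[K] MultilinearMap K (fun i => (B i : Type v)) W) (a : A)
    (b : ∀ i, B i) : iterLift s A B Φ (pure s A B a b) = Φ a b := by
  induction s generalizing A with
  | zero => exact congrArg (Φ a) (Subsingleton.elim (fun i => i.elim0) b)
  | succ s ih =>
    refine (ih (A.tensor (B 0)) _ _ _ _).trans ?_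
    rw [TensorProduct.mk_apply, TensorProduct.lift.tmul]
    exact congrArg (Φ a) (Fin.cons_self_tail b)

/-- The iterated tensor product is generated by the tensors of homogeneous elements. -/
theorem span_pure {s : ℕ} (A : SgnMod.{u, v} K) (B : Fin s → DGMod.{u, v} K) (S : Set A)
    (hS : Submodule.span K S = ⊤) :
    Submodule.span K {x | ∃ a ∈ S, ∃ b : ∀ i, B i, (∃ e : Fin s → ℕ, ∀ i, b i ∈ (B i).gr (e i)) ∧
      x = pure s A B a b} = ⊤ := by
  induction s generalizing A with
  | zero =>
    rw [eq_top_iff]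
    refine hS.symm.le.trans (Submodule.span_mono fun a ha => ?_)
    exact ⟨a, ha, fun i => i.elim0, ⟨Fin.elim0, fun i => i.elim0⟩, rfl⟩
  | succ s ih =>
    have h1 : Submodule.span K (Set.image2 (fun a b => (a ⊗ₜ[K] b : A ⊗[K] B 0)) S
        {x | ∃ k, x ∈ (B 0).gr k}) = ⊤ := by
      have := Submodule.map₂_span_span K (TensorProduct.mk K A (B 0)) S {x | ∃ k, x ∈ (B 0).gr k}
      rw [hS, (B 0).span_homogeneous, TensorProduct.map₂_mk_top_top_eq_top] at this
      exact this.symm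
    have h2 := ih (A.tensor (B 0)) (fun i => B i.succ) _ h1
    refine eq_top_iff.2 (h2.symm.le.trans (Submodule.span_mono ?_))
    rintro _ ⟨_, ⟨a, ha, b₀, ⟨k, hk⟩, rfl⟩, b, ⟨e, he⟩, rfl⟩
    refine ⟨a, ha, (Fin.cons b₀ b : ∀ i, B i), ⟨Fin.cons k e, ?_⟩, ?_⟩
    · intro i
      refine Fin.cases ?_ (fun i => ?_) i
      · exact hk
      · exact he i
    · rfl

/-- The differential of a tensor of homogeneous elements. -/
theorem d_pure {s : ℕ} (A : SgnMod.{u, v} K) (B : Fin s → DGMod.{u, v} K) (α : ℕ) (e : Fin s → ℕ)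
    (a : A) (b : ∀ i, B i) (ha : A.sgn a = (-1 : K) ^ α • a) (hb : ∀ i, b i ∈ (B i).gr (e i)) :
    (iter s A B).d (pure s A B a b) = pure s A B (A.d a) b +
      ∑ i, (-1 : K) ^ (α + ∑ j ∈ Finset.Iio i, e j) •
        pure s A B a (Function.update b i ((B i).d (b i))) := by
  induction s generalizing A α with
  | zero => simp; rfl
  | succ s ih =>
    -- Once b_0 is absorbed in the first factor, that factor has degree α + e 0, which accounts for
    -- the signs of the remaining terms.
    have h := ih (A.tensor (B 0)) (fun i => B i.succ) (α + e 0) (fun i => e i.succ)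
      (a ⊗ₜ[K] b 0 : A ⊗[K] B 0) (fun i => b i.succ) (by
        rw [TensorProduct.map_tmul, ha]
        refine (congrArg _ (DGMod.sgn_of_mem (hb 0))).trans ?_
        rw [TensorProduct.smul_tmul_smul, pow_add]) (fun i => hb i.succ)
    refine h.trans ?_
    change _ = (pure s (A.tensor (B 0)) (fun i => B i.succ) (A.d a ⊗ₜ[K] b 0 : A ⊗[K] B 0)
      (fun i => b i.succ) : iter s (A.tensor (B 0)) fun i => B i.succ) +
      ∑ i, (-1 : K) ^ (α + ∑ j ∈ Finset.Iio i, e j) •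
        pure s (A.tensor (B 0)) (fun i => B i.succ)
          (a ⊗ₜ[K] (Function.update b i ((B i).d (b i)) 0) : A ⊗[K] B 0)
          (fun j => Function.update b i ((B i).d (b i)) j.succ)
    have h1 : (A.tensor (B 0)).d (a ⊗ₜ[K] b 0 : A ⊗[K] B 0) =
        A.d a ⊗ₜ[K] b 0 + (-1 : K) ^ α • (a ⊗ₜ[K] (B 0).d (b 0)) := by
      simp [ha, TensorProduct.smul_tmul']
    have h2 : ∀ i : Fin s, ∑ j ∈ Finset.Iio i.succ, e j = e 0 + ∑ j ∈ Finset.Iio i, e j.succ := by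
      intro i
      have h4 : ∀ {n : ℕ} (i : Fin n) (e : Fin n → ℕ),
          ∑ j ∈ Finset.Iio i, e j = ∑ j, if j < i then e j else 0 := fun i e => by
        rw [← Finset.sum_filter]; congr 1; ext; simp
      rw [h4, h4, Fin.sum_univ_succ]
      simp
    rw [h1, map_add, map_smul, Fin.sum_univ_succ]
    have h3 : ∑ j ∈ Finset.Iio (0 : Fin (s + 1)), e j = 0 :=
      Finset.sum_eq_zero fun j hj => by simp at hj
    simp only [add_apply, smul_apply, h2, h3, add_zero, add_assoc,
      Function.update_self]
    congr 1
    congr 1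
    refine Finset.sum_congr rfl fun i _ => ?_
    rw [Function.update_of_ne (Fin.succ_ne_zero i).symm]
    congr 3
    ext j
    by_cases hj : j = i
    · subst hj; simp
    · rw [Function.update_of_ne hj, Function.update_of_ne (by simpa using hj)]

variable {A A' : SgnMod.{u, v} K}

/-- The iterated tensor product of morphisms. -/
noncomputable def iterHom : (s : ℕ) → {A A' : SgnMod.{u, v} K} → {B B' : Fin s → DGMod.{u, v} K} →
    Hom A A' → (∀ i, DGMod.Hom (B i) (B' i)) → Hom (iter s A B) (iter s A' B')
  | 0, _, _, _, _, f, _ => f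
  | s + 1, _, _, _, _, f, g => iterHom s (f.tensor (g 0)) (fun i => g i.succ)

theorem iterHom_pure {s : ℕ} {B B' : Fin s → DGMod.{u, v} K} (f : Hom A A')
    (g : ∀ i, DGMod.Hom (B i) (B' i)) (a : A) (b : ∀ i, B i) :
    iterHom s f g (pure s A B a b) = pure s A' B' (f a) (fun i => g i (b i)) := by
  induction s generalizing A A' with
  | zero => rfl
  | succ s ih =>
    rw [pure_succ, pure_succ]
    exact ih _ _ _ _

theorem iterHom_isQIso {s : ℕ} {B B' : Fin s → DGMod.{u, v} K} {f : Hom A A'}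
    {g : ∀ i, DGMod.Hom (B i) (B' i)} (hB : ∀ i, Module.Projective K (B i))
    (hB' : ∀ i, Module.Projective K (B' i)) (hf : f.IsQIso) (hg : ∀ i, (g i).toSgnHom.IsQIso) :
    (iterHom s f g).IsQIso := by
  induction s generalizing A A' with
  | zero => exact hf
  | succ s ih =>
    have := hB 0
    have := hB' 0
    exact ih (fun i => hB i.succ) (fun i => hB' i.succ) (hf.tensor (hg 0)) (fun i => hg i.succ)

theorem of_iterHom_isQIso {s : ℕ} {B B' : Fin s → DGMod.{u, v} K} {f : Hom A A'}
    {g : ∀ i, DGMod.Hom (B i) (B' i)} (hB : ∀ i, (B i).IsGroundRing)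
    (hB' : ∀ i, (B' i).IsGroundRing) (hg : ∀ i, (g i).toSgnHom.IsQIso)
    (h : (iterHom s f g).IsQIso) : f.IsQIso := by
  induction s generalizing A A' with
  | zero => exact h
  | succ s ih =>
    exact Hom.IsQIso.of_tensor_groundRing (hB 0) (hB' 0) (hg 0)
      (ih (fun i => hB i.succ) (fun i => hB' i.succ) (fun i => hg i.succ) h)

end SgnMod

/-! ### Koszul signs -/

theorem koszulSign_congr {r s : ℕ} (w : Fin r ≃ Fin s) {e e' : Fin s → ℕ}
    (h : ∀ i, e i % 2 = e' i % 2) : koszulSign K w e = koszulSign K w e' := by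
  unfold koszulSign
  refine Finset.prod_congr rfl fun i _ => Finset.prod_congr rfl fun j _ => ?_
  split_ifs
  · rw [neg_one_pow_eq_pow_mod_two, neg_one_pow_eq_pow_mod_two (n := e' _ * _), Nat.mul_mod, h, h,
      ← Nat.mul_mod]
  · rfl

/-- For symmetric F this is a product over unordered pairs, which no relabelling changes. -/
theorem prod_pairs_comp {q r : ℕ} (σ : Fin q ≃ Fin r) (F : Fin r → Fin r → K)
    (hF : ∀ a b, F a b = F b a) :
    ∏ a, ∏ b, (if a < b then F a b else 1) =
      ∏ i, ∏ j, if i < j then F (σ i) (σ j) else 1 := by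
  have h1 : ∏ i, ∏ j, (if i < j then F (σ i) (σ j) else 1) =
      ∏ a, ∏ b, if σ.symm a < σ.symm b then F a b else 1 := by
    rw [← Equiv.prod_comp σ]
    refine Finset.prod_congr rfl fun i _ => ?_
    rw [← Equiv.prod_comp σ]
    simp
  have h2 : ∀ a b, (if σ.symm a < σ.symm b then F a b else 1) =
      (if a < b ∧ σ.symm a < σ.symm b then F a b else 1) *
        if b < a ∧ σ.symm a < σ.symm b then F a b else 1 := by
    intro a b
    rcases lt_trichotomy a b with h | rfl | h
    · simp [h, h.not_gt]
    · simp
    · simp [h, h.not_gt]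
  have h3 : ∀ a b, (if a < b then F a b else 1) =
      (if a < b ∧ σ.symm a < σ.symm b then F a b else 1) *
        if a < b ∧ σ.symm b < σ.symm a then F b a else 1 := by
    intro a b
    rw [hF b a]
    rcases lt_trichotomy (σ.symm a) (σ.symm b) with h | h | h
    · simp [h, h.not_gt]
    · have := σ.symm.injective h
      subst this; simp
    · simp [h, h.not_gt]
  simp only [h1, h2, h3, Finset.prod_mul_distrib]
  congr 1
  rw [Finset.prod_comm]

/-- A pair is inverted by the composite exactly when one of the two bijections inverts it; a pair
inverted by both contributes a square of ±1. -/
theorem koszulSign_trans {q r s : ℕ} (w : Fin q ≃ Fin r) (w' : Fin r ≃ Fin s) (e : Fin s → ℕ) :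
    koszulSign K (w.trans w') e = koszulSign K w' e * koszulSign K w (fun i => e (w' i)) := by
  set t : Fin r → Fin r → K := fun a b => (-1) ^ (e (w' a) * e (w' b)) with ht
  have htt : ∀ a b, t a b * t a b = 1 := fun a b => by rw [ht, ← mul_pow]; simp
  have hts : ∀ a b, t a b = t b a := fun a b => by simp only [ht, mul_comm]
  -- The symmetric extension of the factors of `koszulSign K w' e`, so that the product can be
  -- reindexed along w.
  set F : Fin r → Fin r → K := fun a b =>
    if (a < b ∧ w' b < w' a) ∨ (b < a ∧ w' a < w' b) then t a b else 1 with hF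
  have h1 : koszulSign K w' e = ∏ a, ∏ b, if a < b then F a b else 1 := by
    refine Finset.prod_congr rfl fun a _ => Finset.prod_congr rfl fun b _ => ?_
    by_cases h : a < b
    · simp [hF, ht, h, h.not_gt]
    · simp [h]
  rw [h1, prod_pairs_comp w F fun a b => by simp only [hF, hts a b, or_comm]]
  simp only [koszulSign, ← Finset.prod_mul_distrib]
  refine Finset.prod_congr rfl fun i _ => Finset.prod_congr rfl fun j _ => ?_
  by_cases hij : i < j
  · simp only [hij, true_and, Equiv.trans_apply, if_true, hF]
    change (if _ then t (w i) (w j) else 1) = _ * if _ then t (w i) (w j) else 1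
    rcases lt_trichotomy (w i) (w j) with h | h | h
    · simp [h, h.not_gt]
    · exact absurd (w.injective h) hij.ne
    · rcases lt_trichotomy (w' (w i)) (w' (w j)) with h' | h' | h'
      · simp [h, h.not_gt, h', h'.not_gt, htt]
      · exact absurd (w.injective (w'.injective h')) hij.ne
      · simp [h, h.not_gt, h', h'.not_gt]
  · simp [hij]

/-- The multilinear map `(y_1, …, y_r) ↦ ± Φ(y_{w(1)}, …, y_{w(s)})`. -/
noncomputable def koszulTwist {r s : ℕ} (w : Fin s ≃ Fin r) (V : Fin r → DGMod.{u, v} K) {W : Type*}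
    [AddCommGroup W] [Module K W] :
    MultilinearMap K (fun i => (V (w i) : Type v)) W →ₗ[K]
      MultilinearMap K (fun j => (V j : Type v)) W where
  -- The sign depends on the degrees, so the formula is multilinear only after splitting each entry.
  -- Only parities matter, which keeps the sum finite.
  toFun Φ := ∑ ε : Fin r → Fin 2, koszulSign K w (fun j => ε j) •
    ((MultilinearMap.domDomCongrLinearEquiv' K K (fun j => (V j : Type v)) W w.symm).symm
      Φ).compLinearMap (fun j => (V j).weight fun k => if k % 2 = ε j then 1 else 0)
  map_add' Φ Φ' := by
    ext y
    simp [Finset.sum_add_distrib]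
  map_smul' c Φ := by
    ext y
    simp [Finset.smul_sum, smul_comm c]

theorem koszulTwist_apply {r s : ℕ} (w : Fin s ≃ Fin r) (V : Fin r → DGMod.{u, v} K) {W : Type*}
    [AddCommGroup W] [Module K W] (Φ : MultilinearMap K (fun i => (V (w i) : Type v)) W)
    (e : Fin r → ℕ) (y : ∀ j, V j) (hy : ∀ j, y j ∈ (V j).gr (e j)) :
    koszulTwist w V Φ y = koszulSign K w e • Φ (fun i => y (w i)) := by
  simp only [koszulTwist, LinearMap.coe_mk, AddHom.coe_mk, sum_apply,
    smul_apply, MultilinearMap.compLinearMap_apply]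
  let ε₀ : Fin r → Fin 2 := fun j => ⟨e j % 2, Nat.mod_lt _ two_pos⟩
  rw [Finset.sum_eq_single ε₀]
  · have h1 : ∀ j, (V j).weight (fun k => if k % 2 = ε₀ j then 1 else 0) (y j) = y j := fun j => by
      rw [DGMod.weight_of_mem (hy j), if_pos rfl, one_smul]
    simp only [h1]
    congr 1
    exact koszulSign_congr w fun j => by simp [ε₀]
  · intro ε _ hε
    obtain ⟨j, hj⟩ := Function.ne_iff.1 hε
    rw [MultilinearMap.map_coord_zero _ j, smul_zero]
    rw [DGMod.weight_of_mem (hy j), if_neg, zero_smul]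
    exact fun h => hj (Fin.ext h.symm)
  · simp

/-! ### Multilinear maps and submodules -/

section Multilinear

variable {ι : Type*} [Finite ι] {M : ι → Type*} [∀ i, AddCommGroup (M i)] [∀ i, Module K (M i)]
  {W : Type*} [AddCommGroup W] [Module K W]

/-- Induction on the set of entries known only to lie in the span; the other entries are already in
S. -/
theorem multilinear_mem_of_span (f : MultilinearMap K M W) (S : ∀ i, Set (M i)) (G : Submodule K W)
    (h : ∀ y, (∀ i, y i ∈ S i) → f y ∈ G) (y : ∀ i, M i)
    (hy : ∀ i, y i ∈ Submodule.span K (S i)) : f y ∈ G := by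
  classical
  have := Fintype.ofFinite ι
  have key : ∀ (T : Finset ι) (y : ∀ i, M i), (∀ i ∈ T, y i ∈ Submodule.span K (S i)) →
      (∀ i ∉ T, y i ∈ S i) → f y ∈ G := by
    intro T
    induction T using Finset.induction_on with
    | empty => exact fun y _ hy => h y fun i => hy i (Finset.notMem_empty i)
    | insert i T hi ih =>
      intro y h1 h2
      have h3 : Submodule.span K (S i) ≤ G.comap (f.toLinearMap y i) := by
        refine Submodule.span_le.2 fun x hx => ?_
        refine ih _ (fun j hj => ?_) fun j hj => ?_
        · rw [Function.update_of_ne (by rintro rfl; exact hi hj)]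
          exact h1 j (Finset.mem_insert_of_mem hj)
        · by_cases hji : j = i
          · subst hji; rwa [Function.update_self]
          · rw [Function.update_of_ne hji]
            exact h2 j (by simp [hji, hj])
      have h4 := h3 (h1 i (Finset.mem_insert_self i T))
      rwa [Submodule.mem_comap, MultilinearMap.toLinearMap_apply, Function.update_eq_self] at h4
  exact key Finset.univ y (fun i _ => hy i) fun i hi => absurd (Finset.mem_univ i) hi

/-- Replace the entries one at a time; each step changes the value by a term with an entry in some D
i. -/
theorem multilinear_sub_mem (f : MultilinearMap K M W) (D : ∀ i, Submodule K (M i))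
    (G : Submodule K W) (h : ∀ y i, y i ∈ D i → f y ∈ G) (y y' : ∀ i, M i)
    (hy : ∀ i, y i - y' i ∈ D i) : f y - f y' ∈ G := by
  classical
  have := Fintype.ofFinite ι
  have key : ∀ T : Finset ι, f (T.piecewise y y') - f y' ∈ G := by
    intro T
    induction T using Finset.induction_on with
    | empty => simp
    | insert i T hi ih =>
      have h1 : f (Finset.piecewise (insert i T) y y') =
          f (Function.update (T.piecewise y y') i (y i - y' i)) + f (T.piecewise y y') := by
        rw [Finset.piecewise_insert]
        have h2 : y i = (y i - y' i) + T.piecewise y y' i := by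
          rw [Finset.piecewise_eq_of_notMem _ _ _ hi, sub_add_cancel]
        nth_rewrite 1 [h2]
        rw [f.map_update_add, Function.update_eq_self]
      rw [h1, add_sub_assoc]
      exact add_mem (h _ i (by simpa using hy i)) ih
  simpa using key Finset.univ

end Multilinear

/-- Lets a doubly indexed family be replaced by one on the concatenated blocks, the form in which
the associativity relation is stated. -/
theorem exists_sigma_eq {r : ℕ} (n : Fin r → ℕ) {X : Fin (∑ i, n i) → Type*}
    (x : ∀ i (a : Fin (n i)), X (finSigmaFinEquiv ⟨i, a⟩)) :
    ∃ z : ∀ k, X k, x = fun i a => z (finSigmaFinEquiv ⟨i, a⟩) := by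
  refine ⟨Equiv.piCongrLeft X finSigmaFinEquiv fun s => x s.1 s.2, ?_⟩
  ext i a
  rw [Equiv.piCongrLeft_apply_apply]

/-- The map f records the block from which each point comes, and u sorts the image of each block. -/
theorem exists_sumEquiv_trans_shuffle_eq {n r : ℕ} (k : Fin r → ℕ) (σ : Fin (∑ i, k i) ≃ Fin n) :
    ∃ (f : Fin n → Fin r) (u : ∀ i, Fin (k i) ≃ Fin (part f i).card),
      (sumEquiv u).trans (shuffle f) = σ := by
  let f : Fin n → Fin r := fun a => (finSigmaFinEquiv.symm (σ.symm a)).1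
  let v : ∀ i, Fin (k i) ≃ part f i := fun i => Equiv.ofBijective
    (fun c => ⟨σ (finSigmaFinEquiv ⟨i, c⟩), by simp [part, f]⟩) (by
      constructor
      · intro c c' h
        simpa using h
      · rintro ⟨a, ha⟩
        have ha' : (finSigmaFinEquiv.symm (σ.symm a)).1 = i := by simpa [part, f] using ha
        subst ha'
        exact ⟨(finSigmaFinEquiv.symm (σ.symm a)).2, by simp⟩)
  refine ⟨f, fun i => (v i).trans ((part f i).orderIsoOfFin rfl).symm.toEquiv, ?_⟩
  ext x
  obtain ⟨⟨i, a⟩, rfl⟩ := finSigmaFinEquiv.surjective x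
  simp [sumEquiv, shuffle, Equiv.sigmaFiberEquiv, v]
  rfl

/-! ### The filtration of a quasi-free module by the arity of operations -/

namespace LeftModule

variable {P : Operad.{u, v} K} (R : LeftModule P)

theorem map_symm_map {m n : ℕ} (σ : Fin m ≃ Fin n) (x : R.obj m) :
    R.map σ.symm (R.map σ x) = x := by
  rw [← R.map_trans, Equiv.self_trans_symm, R.map_refl]

theorem map_map_symm {m n : ℕ} (σ : Fin m ≃ Fin n) (x : R.obj n) :
    R.map σ (R.map σ.symm x) = x := by
  rw [← R.map_trans, Equiv.symm_trans_self, R.map_refl]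

/-- The multilinear map `(y_1, …, y_r) ↦ σ p(y_1, …, y_r)`. -/
noncomputable def opMap {n r : ℕ} (k : Fin r → ℕ) (σ : Fin (∑ i, k i) ≃ Fin n) :
    P.obj r →ₗ[K] MultilinearMap K (fun i => (R.obj (k i) : Type v)) (R.obj n) where
  toFun p := (R.map σ).toLin.compMultilinearMap (R.act.comp k p)
  map_add' p q := by ext; simp
  map_smul' c p := by ext; simp

@[simp] theorem opMap_apply {n r : ℕ} (k : Fin r → ℕ) (σ : Fin (∑ i, k i) ≃ Fin n) (p : P.obj r)
    (y : ∀ i, R.obj (k i)) : R.opMap k σ p y = R.map σ (R.act.comp k p y) := rfl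

end LeftModule

namespace QuasiFree

variable {P : Operad.{u, v} K} {R : LeftModule P} (F : QuasiFree R)

/-- The submodule of `R(n)` spanned by the composites `p(y_1, …, y_r)` of generators `y_i` with
operations `p` of arity `r ≥ s`. -/
def filt (s n : ℕ) : Submodule K (R.obj n) :=
  Submodule.span K {z | ∃ (r : ℕ) (k : Fin r → ℕ) (σ : Fin (∑ i, k i) ≃ Fin n) (a : ℕ)
    (e : Fin r → ℕ) (p : P.obj r) (y : ∀ i, F.gen (k i)),
    s ≤ r ∧ p ∈ (P.obj r).gr a ∧ (∀ i, y i ∈ (F.gen (k i)).gr (e i)) ∧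
      z = R.map σ (R.act.comp k p fun i => F.incl _ (y i))}

theorem filt_anti {s t : ℕ} (h : s ≤ t) (n : ℕ) : F.filt t n ≤ F.filt s n :=
  Submodule.span_mono fun _ ⟨r, k, σ, a, e, p, y, hr, H⟩ => ⟨r, k, σ, a, e, p, y, h.trans hr, H⟩

theorem op_incl_mem {n r : ℕ} (k : Fin r → ℕ) (σ : Fin (∑ i, k i) ≃ Fin n) (p : P.obj r)
    (y : ∀ i, F.gen (k i)) : R.map σ (R.act.comp k p fun i => F.incl _ (y i)) ∈ F.filt r n := by
  induction p using DGMod.hom_induction with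
  | zero => simp
  | add p q hp hq =>
    rw [map_add, add_apply, map_add]
    exact add_mem hp hq
  | hom a p hp =>
    refine multilinear_mem_of_span ((R.opMap k σ p).compLinearMap fun i => F.incl (k i))
      (fun i => {x | ∃ l, x ∈ (F.gen (k i)).gr l}) _ (fun y hy => ?_) y fun i => ?_
    · choose e he using hy
      exact Submodule.subset_span ⟨r, k, σ, a, e, p, y, le_rfl, hp, he, rfl⟩
    · rw [DGMod.span_homogeneous]; trivial

/-- By associativity p(q_1(…), …, q_r(…)) is, up to sign and permutation, the composite of p(q_1, …,
q_r) with the generators, and the arities of the q_i add up. -/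
theorem op_mem {n r : ℕ} (k : Fin r → ℕ) (σ : Fin (∑ i, k i) ≃ Fin n) (t : Fin r → ℕ)
    (p : P.obj r) (y : ∀ i, R.obj (k i)) (hy : ∀ i, y i ∈ F.filt (t i) (k i)) :
    R.map σ (R.act.comp k p y) ∈ F.filt (∑ i, t i) n := by
  refine multilinear_mem_of_span (R.opMap k σ p) _ _ (fun y hy => ?_) y hy
  choose l k' τ b e q z hl hq hz hy using hy
  obtain rfl : y = _ := funext hy
  obtain ⟨m, rfl⟩ := exists_sigma_eq l (X := fun _ => ℕ) k'
  obtain ⟨e, rfl⟩ := exists_sigma_eq l (X := fun _ => ℕ) e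
  obtain ⟨z, rfl⟩ := exists_sigma_eq l (X := fun k => F.gen (m k)) z
  have hz' : ∀ k, z k ∈ (F.gen (m k)).gr (e k) := fun k => by
    obtain ⟨⟨i, a⟩, rfl⟩ := finSigmaFinEquiv.surjective k
    exact hz i a
  have h1 := R.assoc l m b e p q (fun k => F.incl _ (z k)) hq fun k => F.incl_mem _ _ _ (hz' k)
  have h2 : ∀ c : ℕ, (-1 : K) ^ c * (-1) ^ c = 1 := fun c => by rw [← mul_pow]; simp
  rw [LeftModule.opMap_apply, R.act.comp_map_inner]
  have h3 := congrArg (fun x => (-1 : K) ^ (∑ i, ∑ j ∈ Finset.Iio i, b i *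
    ∑ a, e (finSigmaFinEquiv ⟨j, a⟩)) • R.map (finCongr (sum_sum_finSigma l m)).symm x) h1
  simp only [map_smul, smul_smul, h2, one_smul, R.map_symm_map] at h3
  rw [← h3, map_smul, map_smul, ← R.map_trans, ← R.map_trans]
  refine Submodule.smul_mem _ _ (F.filt_anti (Finset.sum_le_sum fun i _ => hl i) n ?_)
  exact F.op_incl_mem _ _ _ _

/-- This is the surjectivity of the canonical map P ∘ R̄ → R. -/
theorem mem_filt_zero {n : ℕ} (x : R.obj n) : x ∈ F.filt 0 n := by
  classical
  obtain ⟨x, rfl⟩ := (F.bijective n).2 x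
  obtain ⟨x, rfl⟩ := Submodule.mkQ_surjective _ x
  change preCanonical R F.gen F.incl n x ∈ F.filt 0 n
  induction x using DirectSum.induction_on with
  | zero => simp
  | add x y hx hy => rw [map_add]; exact add_mem hx hy
  | of i x =>
    obtain ⟨r, f⟩ := i
    induction x using TensorProduct.induction_on with
    | zero => simp
    | add x y hx hy => rw [map_add, map_add]; exact add_mem hx hy
    | tmul p y =>
      induction y using PiTensorProduct.induction_on with
      | smul_tprod c y =>
        have h := preCanonical_of R F.gen F.incl f (c • p) y
        have h2 : PreComposite.of P.toSymMod F.gen f (c • p) y = DirectSum.of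
            (fun x : (Σ r : ℕ, (Fin n → Fin r)) =>
              (P.toSymMod x.1 ⊗[K] (⨂[K] i : Fin x.1, (F.gen (part x.2 i).card : Type v))))
            ⟨r, f⟩ (p ⊗ₜ[K] (c • PiTensorProduct.tprod K y)) := by
          rw [TensorProduct.tmul_smul, TensorProduct.smul_tmul']
          unfold PreComposite.of
          rw [DirectSum.lof_eq_of]
          congr!
        rw [h2] at h
        rw [h]
        exact F.filt_anti (Nat.zero_le r) n (F.op_incl_mem _ _ _ _)
      | add x y hx hy =>
        rw [TensorProduct.tmul_add, map_add, map_add]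
        exact add_mem hx hy

theorem mem_filt_one (hP : P.IsConnected) {n : ℕ} (x : R.obj n) : x ∈ F.filt 1 n := by
  have h : F.filt 0 n ≤ F.filt 1 n := by
    refine Submodule.span_le.2 ?_
    rintro _ ⟨r, k, σ, a, e, p, y, -, hp, hy, rfl⟩
    rcases Nat.eq_zero_or_pos r with rfl | hr
    · have := hP.1
      rw [Subsingleton.elim p 0]
      simp
    · exact F.filt_anti hr n (F.op_incl_mem _ _ _ _)
  exact h (F.mem_filt_zero x)

theorem op_mem_filt (hP : P.IsConnected) {n r : ℕ} (k : Fin r → ℕ) (σ : Fin (∑ i, k i) ≃ Fin n)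
    (p : P.obj r) (y : ∀ i, R.obj (k i)) : R.map σ (R.act.comp k p y) ∈ F.filt r n := by
  have := F.op_mem k σ (fun _ => 1) p y fun i => F.mem_filt_one hP _
  simpa using this

theorem filt_two (hP : P.IsConnected) (n : ℕ) : F.filt 2 n = R.decomposables n := by
  refine le_antisymm (Submodule.span_le.2 ?_) (Submodule.span_le.2 ?_)
  · rintro _ ⟨r, k, σ, a, e, p, y, hr, hp, hy, rfl⟩
    exact LeftModule.mem_decomposables σ (by omega) hp fun i => F.incl_mem _ _ _ (hy i)
  · rintro _ ⟨r, k, σ, a, e, p, y, hr, hp, hy, rfl⟩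
    rcases Nat.eq_zero_or_pos r with rfl | hr'
    · have := hP.1
      rw [Subsingleton.elim p 0]
      simp
    · exact F.filt_anti (by omega) n (F.op_mem_filt hP _ _ _ _)

/-- The decomposable entry counts for 2 and each of the other r - 1 entries for 1. -/
theorem op_mem_filt_succ (hP : P.IsConnected) {n r : ℕ} (k : Fin r → ℕ)
    (σ : Fin (∑ i, k i) ≃ Fin n) (p : P.obj r) (y : ∀ i, R.obj (k i)) (j : Fin r)
    (hj : y j ∈ R.decomposables (k j)) : R.map σ (R.act.comp k p y) ∈ F.filt (r + 1) n := by
  have := F.op_mem k σ (Function.update (fun _ => 1) j 2) p y fun i => by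
    by_cases h : i = j
    · subst h; rwa [Function.update_self, F.filt_two hP]
    · rw [Function.update_of_ne h]; exact F.mem_filt_one hP _
  rw [Finset.sum_update_of_mem (Finset.mem_univ j)] at this
  refine F.filt_anti ?_ n this
  have hr := j.pos
  rw [Finset.sum_const, Finset.sdiff_singleton_eq_erase,
    Finset.card_erase_of_mem (Finset.mem_univ j), Finset.card_univ, Fintype.card_fin, smul_eq_mul]
  omega

/-- Modulo the next stage a composite depends only on the classes of its entries modulo
decomposables. This removes both the twist of the differential and the higher terms of ψ from the
graded pieces. -/
theorem op_sub_op_mem (hP : P.IsConnected) {n r : ℕ} (k : Fin r → ℕ)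
    (σ : Fin (∑ i, k i) ≃ Fin n) (p : P.obj r) (y y' : ∀ i, R.obj (k i))
    (h : ∀ i, y i - y' i ∈ R.decomposables (k i)) :
    R.map σ (R.act.comp k p y) - R.map σ (R.act.comp k p y') ∈ F.filt (r + 1) n :=
  multilinear_sub_mem (R.opMap k σ p) _ _ (fun y j hj => F.op_mem_filt_succ hP k σ p y j hj) y y' h

/-- The differential of a generator may be any element of R, but every element lies in stage 1, so
the number of inputs does not drop. -/
theorem d_filt (hP : P.IsConnected) {s n : ℕ} {x : R.obj n} (hx : x ∈ F.filt s n) :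
    (R.obj n).d x ∈ F.filt s n := by
  have h : F.filt s n ≤ (F.filt s n).comap (R.obj n).d := by
    refine Submodule.span_le.2 ?_
    rintro _ ⟨r, k, σ, a, e, p, y, hr, hp, hy, rfl⟩
    change (R.obj n).d _ ∈ F.filt s n
    rw [← (R.map σ).map_d, R.act.d_comp k a e p _ hp fun i => F.incl_mem _ _ _ (hy i), map_add,
      map_sum]
    refine add_mem (F.filt_anti hr n (F.op_incl_mem _ _ _ _)) (sum_mem fun i _ => ?_)
    rw [map_smul]
    exact Submodule.smul_mem _ _ (F.filt_anti hr n (F.op_mem_filt hP _ _ _ _))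
  exact h hx

/-- More than n inputs with total arity n leave one input of arity 0, where the generators vanish.
-/
theorem filt_eq_bot (h0 : F.gen.IsConnected) {s n : ℕ} (h : n < s) : F.filt s n = ⊥ := by
  refine Submodule.span_eq_bot.2 ?_
  rintro _ ⟨r, k, σ, a, e, p, y, hr, hp, hy, rfl⟩
  have hcard : ∑ i, k i = n := by simpa using Fintype.card_congr σ
  obtain ⟨i, hi⟩ : ∃ i, k i = 0 := by
    by_contra! hne
    have : ∑ _i : Fin r, 1 ≤ ∑ i, k i :=
      Finset.sum_le_sum fun i _ => Nat.one_le_iff_ne_zero.2 (hne i)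
    simp at this
    omega
  have hs : Subsingleton (F.gen (k i)) := by rw [hi]; exact h0
  rw [MultilinearMap.map_coord_zero _ i, map_zero]
  rw [Subsingleton.elim (y i) 0, map_zero]

end QuasiFree

/-! ### The graded pieces of the filtration -/

theorem part_equiv_comp {n r s : ℕ} (w : Fin s ≃ Fin r) {f : Fin n → Fin s} {g : Fin n → Fin r}
    (h : w ∘ f = g) (i : Fin s) : part g (w i) = part f i := by
  subst h; ext; simp [part]

theorem koszulSign_refl {r : ℕ} (e : Fin r → ℕ) : koszulSign K (Equiv.refl (Fin r)) e = 1 := by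
  unfold koszulSign
  refine Finset.prod_eq_one fun i _ => Finset.prod_eq_one fun j _ => if_neg ?_
  exact fun h => lt_asymm h.1 h.2

/-- The differential module `M(s) ⊗ N(J_1) ⊗ ⋯ ⊗ N(J_s)`, where `J_i = f⁻¹(i)`. -/
noncomputable abbrev block (M N : SymMod.{u, v} K) {n s : ℕ} (f : Fin n → Fin s) :
    SgnMod.{u, v} K :=
  SgnMod.iter s (M s).toSgnMod fun i => N (part f i).card

/-- The tensor `p ⊗ y_1 ⊗ ⋯ ⊗ y_s`. -/
noncomputable abbrev blockPure (M N : SymMod.{u, v} K) {n s : ℕ} (f : Fin n → Fin s) :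
    M s →ₗ[K] MultilinearMap K (fun i => (N (part f i).card : Type v)) (block M N f) :=
  SgnMod.pure s (M s).toSgnMod fun i => N (part f i).card

theorem block_induction {M N : SymMod.{u, v} K} {n s : ℕ} {f : Fin n → Fin s}
    (G : Submodule K (block M N f))
    (h : ∀ (a : ℕ) (e : Fin s → ℕ) (p : M s) (y : ∀ i, N (part f i).card), p ∈ (M s).gr a →
      (∀ i, y i ∈ (N _).gr (e i)) → blockPure M N f p y ∈ G) (t : block M N f) : t ∈ G := by
  have h1 := SgnMod.span_pure (M s).toSgnMod (fun i => N (part f i).card) _ (M s).span_homogeneous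
  have h2 : t ∈ (⊤ : Submodule K (block M N f)) := trivial
  rw [← h1] at h2
  refine Submodule.span_le.2 ?_ h2
  rintro _ ⟨p, ⟨a, hp⟩, y, ⟨e, hy⟩, rfl⟩
  exact h a e p y hp hy

/-- The map `p ⊗ y ↦ ± w⁻¹(p) ⊗ (y_{w(1)} ⊗ ⋯ ⊗ y_{w(s)})`, which identifies the summands of the
composition product with index `f` and `g = w ∘ f`. -/
noncomputable def blockTwist (M N : SymMod.{u, v} K) {n r s : ℕ} (f : Fin n → Fin s)
    (g : Fin n → Fin r) (w : Fin s ≃ Fin r) (hw : w ∘ f = g) :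
    M r →ₗ[K] MultilinearMap K (fun j => (N (part g j).card : Type v)) (block M N f) :=
  koszulTwist w (fun j => N (part g j).card) ∘ₗ
    { toFun := fun p => (blockPure M N f (M.map w.symm p)).compLinearMap fun i =>
        (N.map (finCongr (congrArg Finset.card (part_equiv_comp w hw i)))).toLin
      map_add' := fun p q => by ext; simp
      map_smul' := fun c p => by ext; simp }

theorem blockTwist_apply (M N : SymMod.{u, v} K) {n r s : ℕ} (f : Fin n → Fin s)
    (g : Fin n → Fin r) (w : Fin s ≃ Fin r) (hw : w ∘ f = g) (p : M r) (e : Fin r → ℕ)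
    (y : ∀ j, N (part g j).card) (hy : ∀ j, y j ∈ (N _).gr (e j)) :
    blockTwist M N f g w hw p y = koszulSign K w e • blockPure M N f (M.map w.symm p) fun i =>
      N.map (finCongr (congrArg Finset.card (part_equiv_comp w hw i))) (y (w i)) := by
  rw [blockTwist, LinearMap.comp_apply, koszulTwist_apply w _ _ e y hy]
  rfl

open Classical in
/-- The projection of the composition product onto the summand of index `f`. -/
noncomputable def preProj (M N : SymMod.{u, v} K) {n s : ℕ} (f : Fin n → Fin s) :
    PreComposite M N n →ₗ[K] block M N f :=
  letI := Classical.decEq (Σ r : ℕ, (Fin n → Fin r))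
  DirectSum.toModule K _ _ fun x => TensorProduct.lift
    ((PiTensorProduct.lift (R := K)).toLinearMap ∘ₗ
      if h : ∃ w : Fin s ≃ Fin x.1, w ∘ f = x.2 then blockTwist M N f x.2 h.choose h.choose_spec
      else 0)

theorem preProj_of_not_exists {M N : SymMod.{u, v} K} {n r s : ℕ} (f : Fin n → Fin s)
    (g : Fin n → Fin r) (h : ¬∃ w : Fin s ≃ Fin r, w ∘ f = g) (p : M r)
    (y : ∀ j, N (part g j).card) : preProj M N f (PreComposite.of M N g p y) = 0 := by
  unfold preProj PreComposite.of
  rw [DirectSum.toModule_lof, dif_neg h]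
  simp

/-- Surjectivity of f makes w unique, so the w chosen in `preProj` is the given one. This is the
freeness of the action on surjections. -/
theorem preProj_of {M N : SymMod.{u, v} K} {n r s : ℕ} (f : Fin n → Fin s)
    (hf : Function.Surjective f) (g : Fin n → Fin r) (w : Fin s ≃ Fin r) (hw : w ∘ f = g) (p : M r)
    (e : Fin r → ℕ) (y : ∀ j, N (part g j).card) (hy : ∀ j, y j ∈ (N _).gr (e j)) :
    preProj M N f (PreComposite.of M N g p y) =
      koszulSign K w e • blockPure M N f (M.map w.symm p) fun i =>
        N.map (finCongr (congrArg Finset.card (part_equiv_comp w hw i))) (y (w i)) := by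
  have h : ∃ w : Fin s ≃ Fin r, w ∘ f = g := ⟨w, hw⟩
  have h1 : h.choose = w := by
    ext i
    obtain ⟨a, rfl⟩ := hf i
    exact congrArg Fin.val (congrFun (h.choose_spec.trans hw.symm) a)
  have h2 : ∀ (w' : Fin s ≃ Fin r) (hw' : w' ∘ f = g), w' = w →
      blockTwist M N f g w' hw' = blockTwist M N f g w hw := by
    rintro _ _ rfl; rfl
  rw [← blockTwist_apply M N f g w hw p e y hy, ← h2 _ h.choose_spec h1]
  unfold preProj PreComposite.of
  rw [DirectSum.toModule_lof, dif_pos h]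
  simp

/-- Both sides of a relation are transported to the same index f, along w₀.trans w and w₀, and
`koszulSign_trans` says that the signs agree. An index outside the orbit of f is sent to zero on
both sides. -/
theorem compositeRelations_le_ker_preProj (M N : SymMod.{u, v} K) {n s : ℕ} (f : Fin n → Fin s)
    (hf : Function.Surjective f) :
    compositeRelations M N n ≤ LinearMap.ker (preProj M N f) := by
  refine Submodule.span_le.2 ?_
  rintro _ ⟨r, w, g, p, e, y, hy, rfl⟩
  rw [SetLike.mem_coe, LinearMap.mem_ker, map_sub, map_smul, sub_eq_zero]
  by_cases h : ∃ w₀ : Fin s ≃ Fin r, w₀ ∘ f = g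
  · obtain ⟨w₀, rfl⟩ := h
    rw [preProj_of f hf _ (w₀.trans w) (by ext; simp) _ e y hy,
      preProj_of f hf _ w₀ rfl p (fun i => e (w i)) _
        fun j => (N.map _).map_mem _ _ (hy (w j)), koszulSign_trans, smul_smul]
    congr 2
    · rw [← M.map_trans, show w.trans (w₀.trans w).symm = w₀.symm by ext; simp]
    · ext i
      rw [← N.map_trans]
      rfl
  · rw [preProj_of_not_exists f g h, preProj_of_not_exists f, smul_zero]
    rintro ⟨w₁, hw₁⟩
    refine h ⟨w₁.trans w.symm, ?_⟩
    ext a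
    simpa using congrArg Fin.val (congrArg w.symm (congrFun hw₁ a))

/-- Surjections `{1, …, n} → {1, …, s}` up to permutations of `{1, …, s}`: the partitions of
`{1, …, n}` into `s` non-empty parts. -/
def surjSetoid (n s : ℕ) : Setoid {f : Fin n → Fin s // Function.Surjective f} where
  r f g := ∃ w : Equiv.Perm (Fin s), w ∘ f.1 = g.1
  iseqv :=
    { refl := fun f => ⟨Equiv.refl _, rfl⟩
      symm := by
        rintro f g ⟨w, hw⟩
        exact ⟨w.symm, by rw [← hw]; ext; simp⟩
      trans := by
        rintro f g h ⟨w, hw⟩ ⟨w', hw'⟩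
        exact ⟨w.trans w', by rw [← hw', ← hw]; rfl⟩ }

/-- The partitions of `{1, …, n}` into `s` non-empty parts. -/
abbrev SetPartition (n s : ℕ) : Type := Quotient (surjSetoid n s)

/-- A chosen ordering of the parts. -/
noncomputable def SetPartition.rep {n s : ℕ} (x : SetPartition n s) : Fin n → Fin s := x.out.1

theorem SetPartition.rep_surjective {n s : ℕ} (x : SetPartition n s) : Function.Surjective x.rep :=
  x.out.2

theorem SetPartition.exists_rep {n s : ℕ} {g : Fin n → Fin s} (hg : Function.Surjective g) :
    ∃ (x : SetPartition n s) (w : Equiv.Perm (Fin s)), w ∘ x.rep = g :=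
  ⟨Quotient.mk _ ⟨g, hg⟩, Quotient.mk_out (s := surjSetoid n s) ⟨g, hg⟩⟩

theorem SetPartition.eq_of_comp_rep {n s : ℕ} {x y : SetPartition n s}
    (h : ∃ w : Fin s ≃ Fin s, w ∘ x.rep = y.rep) : x = y := by
  rw [← Quotient.out_eq x, ← Quotient.out_eq y]
  exact Quotient.sound (s := surjSetoid n s) h

/-! ### Identification of the graded pieces with sums of blocks -/

namespace QuasiFree

variable {P : Operad.{u, v} K} {R : LeftModule P} (F : QuasiFree R)

/-- The map `p ⊗ y_1 ⊗ ⋯ ⊗ y_s ↦ p(y_1, …, y_s)`. -/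
noncomputable def blockMap {n s : ℕ} (f : Fin n → Fin s) :
    block P.toSymMod F.gen f →ₗ[K] R.obj n :=
  SgnMod.iterLift s (P.obj s).toSgnMod (fun i => F.gen (part f i).card)
    { toFun := fun p => (R.opMap _ (shuffle f) p).compLinearMap fun i => F.incl _
      map_add' := fun p q => by ext; simp
      map_smul' := fun c p => by ext; simp }

theorem blockMap_pure {n s : ℕ} (f : Fin n → Fin s) (p : P.obj s)
    (y : ∀ i, F.gen (part f i).card) : F.blockMap f (blockPure P.toSymMod F.gen f p y) =
      R.map (shuffle f) (R.act.comp _ p fun i => F.incl _ (y i)) :=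
  SgnMod.iterLift_pure _ _ _ _ _

theorem blockMap_mem {n s : ℕ} (f : Fin n → Fin s) (t : block P.toSymMod F.gen f) :
    F.blockMap f t ∈ F.filt s n := by
  refine block_induction ((F.filt s n).comap (F.blockMap f)) (fun a e p y _ _ => ?_) t
  rw [Submodule.mem_comap, F.blockMap_pure]
  exact F.op_incl_mem _ _ _ _

/-- The signs of the two derivation formulas coincide, so the difference is a sum of composites in
which an entry d(ι y_i) is replaced by ι(d y_i). These differ by a decomposable element. -/
theorem blockMap_d (hP : P.IsConnected) {n s : ℕ} (f : Fin n → Fin s)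
    (t : block P.toSymMod F.gen f) :
    F.blockMap f ((block P.toSymMod F.gen f).d t) - (R.obj n).d (F.blockMap f t) ∈
      F.filt (s + 1) n := by
  refine block_induction ((F.filt (s + 1) n).comap
    (F.blockMap f ∘ₗ (block P.toSymMod F.gen f).d - (R.obj n).d ∘ₗ F.blockMap f))
    (fun a e p y hp hy => ?_) t
  have hd : (block P.toSymMod F.gen f).d (blockPure P.toSymMod F.gen f p y) =
      blockPure P.toSymMod F.gen f ((P.obj s).d p) y +
        ∑ i, (-1 : K) ^ (a + ∑ j ∈ Finset.Iio i, e j) •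
          blockPure P.toSymMod F.gen f p (Function.update y i ((F.gen _).d (y i))) :=
    SgnMod.d_pure (P.obj s).toSgnMod _ a e p y (DGMod.sgn_of_mem hp) hy
  rw [Submodule.mem_comap, LinearMap.sub_apply, LinearMap.comp_apply, LinearMap.comp_apply,
    F.blockMap_pure, ← (R.map _).map_d,
    R.act.d_comp _ a e p _ hp fun i => F.incl_mem _ _ _ (hy i), hd]
  simp only [map_add, map_sum, map_smul]
  rw [F.blockMap_pure, add_sub_add_left_eq_sub, ← Finset.sum_sub_distrib]
  refine sum_mem fun i _ => ?_
  rw [← smul_sub, F.blockMap_pure]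
  refine Submodule.smul_mem _ _ (F.op_sub_op_mem hP _ _ _ _ _ fun j => ?_)
  by_cases h : j = i
  · subst h
    rw [Function.update_self, Function.update_self, ← neg_sub]
    exact neg_mem (F.twist_mem _ _)
  · rw [Function.update_of_ne h, Function.update_of_ne h, sub_self]
    exact zero_mem _

/-- The isomorphism `P ∘ R̄ ≃ R`. -/
noncomputable def equiv (n : ℕ) : Composite P.toSymMod F.gen n ≃ₗ[K] R.obj n :=
  LinearEquiv.ofBijective _ (F.bijective n)

theorem equiv_of {n r : ℕ} (g : Fin n → Fin r) (p : P.obj r) (y : ∀ i, F.gen (part g i).card) :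
    F.equiv n (Submodule.mkQ _ (PreComposite.of P.toSymMod F.gen g p y)) =
      R.map (shuffle g) (R.act.comp _ p fun i => F.incl _ (y i)) :=
  preCanonical_of R F.gen F.incl g p y

/-- The projection of `R(n)` onto the summand of index `f`. -/
noncomputable def blockProj {n s : ℕ} (f : Fin n → Fin s) (hf : Function.Surjective f) :
    R.obj n →ₗ[K] block P.toSymMod F.gen f :=
  (compositeRelations P.toSymMod F.gen n).liftQ _
    (compositeRelations_le_ker_preProj P.toSymMod F.gen f hf) ∘ₗ (F.equiv n).symm.toLinearMap

theorem blockProj_op {n r s : ℕ} (f : Fin n → Fin s) (hf : Function.Surjective f)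
    (g : Fin n → Fin r) (p : P.obj r) (y : ∀ i, F.gen (part g i).card) :
    F.blockProj f hf (R.map (shuffle g) (R.act.comp _ p fun i => F.incl _ (y i))) =
      preProj P.toSymMod F.gen f (PreComposite.of P.toSymMod F.gen g p y) := by
  rw [← F.equiv_of, blockProj, LinearMap.comp_apply, LinearEquiv.coe_coe,
    LinearEquiv.symm_apply_apply]
  rfl

/-- Inner equivariance absorbs the permutations inside the blocks into the generators, leaving only
a shuffle. -/
theorem op_incl_eq {n r : ℕ} (k : Fin r → ℕ) (σ : Fin (∑ i, k i) ≃ Fin n) :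
    ∃ (g : Fin n → Fin r) (u : ∀ i, Fin (k i) ≃ Fin (part g i).card), ∀ (p : P.obj r)
      (y : ∀ i, F.gen (k i)), R.map σ (R.act.comp k p fun i => F.incl _ (y i)) =
        R.map (shuffle g) (R.act.comp _ p fun i => F.incl _ (F.gen.map (u i) (y i))) := by
  obtain ⟨g, u, rfl⟩ := exists_sumEquiv_trans_shuffle_eq k σ
  refine ⟨g, u, fun p y => ?_⟩
  simp only [F.incl_map]
  rw [R.act.comp_map_inner, R.map_trans]

theorem blockProj_of_mem {n s : ℕ} (f : Fin n → Fin s) (hf : Function.Surjective f) {x : R.obj n}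
    (hx : x ∈ F.filt (s + 1) n) : F.blockProj f hf x = 0 := by
  refine (Submodule.span_le.2 ?_ : F.filt (s + 1) n ≤ LinearMap.ker (F.blockProj f hf)) hx
  rintro _ ⟨r, k, σ, a, e, p, y, hr, hp, hy, rfl⟩
  obtain ⟨g, u, hg⟩ := F.op_incl_eq k σ
  rw [SetLike.mem_coe, LinearMap.mem_ker, hg, F.blockProj_op]
  refine preProj_of_not_exists f g ?_ p _
  rintro ⟨w, -⟩
  have : s = r := by simpa using Fintype.card_congr w
  omega

theorem blockProj_blockMap {n s : ℕ} (f : Fin n → Fin s) (hf : Function.Surjective f)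
    (t : block P.toSymMod F.gen f) : F.blockProj f hf (F.blockMap f t) = t := by
  refine block_induction (LinearMap.eqLocus (F.blockProj f hf ∘ₗ F.blockMap f) LinearMap.id)
    (fun a e p y hp hy => ?_) t
  rw [LinearMap.mem_eqLocus, LinearMap.id_apply, LinearMap.comp_apply, F.blockMap_pure,
    F.blockProj_op, preProj_of f hf f (Equiv.refl _) rfl p e y hy, koszulSign_refl, one_smul]
  congr 1
  · exact congrArg _ (P.map_refl s p)
  · ext i
    exact F.gen.map_refl _ (y i)

theorem blockProj_blockMap_of_not_exists {n r s : ℕ} (f : Fin n → Fin s)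
    (hf : Function.Surjective f) (g : Fin n → Fin r) (h : ¬∃ w : Fin s ≃ Fin r, w ∘ f = g)
    (t : block P.toSymMod F.gen g) : F.blockProj f hf (F.blockMap g t) = 0 := by
  refine block_induction (LinearMap.ker (F.blockProj f hf ∘ₗ F.blockMap g))
    (fun a e p y hp hy => ?_) t
  rw [LinearMap.mem_ker, LinearMap.comp_apply, F.blockMap_pure, F.blockProj_op,
    preProj_of_not_exists f g h]

/-- The coinvariant relation, read through P ∘ R̄ ≃ R, moves a reordering of the parts onto the
operation. -/
theorem op_shuffle_eq {n s : ℕ} (f : Fin n → Fin s) (w : Equiv.Perm (Fin s)) (p : P.obj s)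
    (e : Fin s → ℕ) (y : ∀ i, F.gen (part (w ∘ f) i).card) (hy : ∀ i, y i ∈ (F.gen _).gr (e i)) :
    ∃ t, R.map (shuffle (w ∘ f)) (R.act.comp _ p fun i => F.incl _ (y i)) = F.blockMap f t := by
  refine ⟨koszulSign K w e • blockPure P.toSymMod F.gen f (P.map w.symm p) (fun i =>
    F.gen.map (finCongr (congrArg Finset.card (part_comp w f i))) (y (w i))), ?_⟩
  have h1 : P.map w (P.map w.symm p) = p := by
    rw [← P.map_trans, Equiv.symm_trans_self, P.map_refl]
  have h2 : PreComposite.of P.toSymMod F.gen (w ∘ f) (P.map w (P.map w.symm p)) y -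
      koszulSign K w e • PreComposite.of P.toSymMod F.gen f (P.map w.symm p) (fun i =>
        F.gen.map (finCongr (congrArg Finset.card (part_comp w f i))) (y (w i))) ∈
      compositeRelations P.toSymMod F.gen n :=
    Submodule.subset_span ⟨s, w, f, _, e, y, hy, rfl⟩
  rw [h1] at h2
  have h3 := congrArg (F.equiv n) ((Submodule.Quotient.mk_eq_zero _).2 h2)
  rw [← Submodule.mkQ_apply, map_sub, map_sub, map_smul, map_smul, F.equiv_of, F.equiv_of, map_zero,
    sub_eq_zero] at h3
  rw [h3, map_smul, F.blockMap_pure]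

/-- A composite with exactly s inputs is indexed by a map to {1, …, s}. If the map is not
surjective, an empty part kills the composite; otherwise the parts can be put in the chosen order.
-/
theorem exists_sub_sum_blockMap_mem (h0 : F.gen.IsConnected) {n s : ℕ} [Fintype (SetPartition n s)]
    {x : R.obj n} (hx : x ∈ F.filt s n) :
    ∃ t : ∀ z : SetPartition n s, block P.toSymMod F.gen z.rep,
      x - ∑ z, F.blockMap z.rep (t z) ∈ F.filt (s + 1) n := by
  classical
  let c : (∀ z : SetPartition n s, block P.toSymMod F.gen z.rep) →ₗ[K] R.obj n :=
    ∑ z : SetPartition n s, F.blockMap z.rep ∘ₗ LinearMap.proj z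
  have hc : ∀ t, c t = ∑ z, F.blockMap z.rep (t z) := fun t => by simp [c]
  have h : F.filt s n ≤ LinearMap.range c ⊔ F.filt (s + 1) n := by
    refine Submodule.span_le.2 ?_
    rintro _ ⟨r, k, σ, a, e, p, y, hr, hp, hy, rfl⟩
    rcases hr.eq_or_lt with rfl | hr
    · refine Submodule.mem_sup_left ?_
      obtain ⟨g, u, hg⟩ := F.op_incl_eq k σ
      rw [hg]
      by_cases hs : Function.Surjective g
      · obtain ⟨z, w, rfl⟩ := SetPartition.exists_rep hs
        obtain ⟨t, ht⟩ := F.op_shuffle_eq z.rep w p e (fun i => F.gen.map (u i) (y i))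
          fun i => (F.gen.map _).map_mem _ _ (hy i)
        refine ⟨Pi.single z t, ?_⟩
        rw [ht, hc, Finset.sum_eq_single z]
        · simp
        · intro z' _ hz'
          simp [hz']
        · simp
      · obtain ⟨i, hi⟩ := not_forall.1 hs
        have hz : (part g i).card = 0 := by
          rw [Finset.card_eq_zero, part, Finset.filter_eq_empty_iff]
          exact fun a _ ha => hi ⟨a, ha⟩
        have hsub : Subsingleton (F.gen (part g i).card) := by rw [hz]; exact h0
        rw [MultilinearMap.map_coord_zero _ i, map_zero]
        · exact zero_mem _
        · rw [Subsingleton.elim (F.gen.map (u i) (y i)) 0, map_zero]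
    · exact Submodule.mem_sup_right (F.filt_anti hr n (F.op_incl_mem _ _ _ _))
  obtain ⟨_, ⟨t, rfl⟩, y, hy, hxy⟩ := Submodule.mem_sup.1 (h hx)
  exact ⟨t, by rw [← hc, ← hxy, add_sub_cancel_left]; exact hy⟩

/-- The projection onto the sum of the blocks with `s` parts. -/
noncomputable def grProj (n s : ℕ) :
    R.obj n →ₗ[K] ∀ z : SetPartition n s, block P.toSymMod F.gen z.rep :=
  LinearMap.pi fun z => F.blockProj z.rep z.rep_surjective

theorem grProj_of_mem {n s : ℕ} {x : R.obj n} (hx : x ∈ F.filt (s + 1) n) : F.grProj n s x = 0 :=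
  funext fun z => F.blockProj_of_mem z.rep z.rep_surjective hx

theorem grProj_sum {n s : ℕ} [Fintype (SetPartition n s)]
    (t : ∀ z : SetPartition n s, block P.toSymMod F.gen z.rep) :
    F.grProj n s (∑ z, F.blockMap z.rep (t z)) = t := by
  ext z
  rw [map_sum, Finset.sum_apply, Finset.sum_eq_single z]
  · exact F.blockProj_blockMap z.rep z.rep_surjective _
  · intro z' _ hz'
    exact F.blockProj_blockMap_of_not_exists z.rep z.rep_surjective _
      (fun h => hz' (SetPartition.eq_of_comp_rep h).symm) _
  · simp

/-- The differential of the sum of the blocks with `s` parts. -/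
noncomputable abbrev grD (M N : SymMod.{u, v} K) (n s : ℕ) :
    (∀ z : SetPartition n s, block M N z.rep) →ₗ[K] ∀ z : SetPartition n s, block M N z.rep :=
  LinearMap.pi fun z => (block M N z.rep).d ∘ₗ LinearMap.proj z

/-- The maps `blockMap` split `grProj` and span the stage modulo the next one. They commute with
differentials only modulo the next stage, which is all that the quotient sees. -/
theorem exactStep (hP : P.IsConnected) (h0 : F.gen.IsConnected) (n s : ℕ) :
    ExactStep (R.obj n).d (F.filt s n) (F.filt (s + 1) n) (grD P.toSymMod F.gen n s)
      (F.grProj n s) where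
  le := F.filt_anti (Nat.le_succ s) n
  d_d x _ := (R.obj n).d_d x
  d_mem x hx := F.d_filt hP hx
  d_mem' x hx := F.d_filt hP hx
  map_d x hx := by
    classical
    have := Fintype.ofFinite (SetPartition n s)
    obtain ⟨t, ht⟩ := F.exists_sub_sum_blockMap_mem h0 hx
    have h1 := F.grProj_of_mem ht
    rw [map_sub, F.grProj_sum, sub_eq_zero] at h1
    have h2 := F.grProj_of_mem (F.d_filt hP ht)
    have h3 : ∑ z, F.blockMap z.rep ((block P.toSymMod F.gen z.rep).d (t z)) -
        (R.obj n).d (∑ z, F.blockMap z.rep (t z)) ∈ F.filt (s + 1) n := by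
      rw [map_sum, ← Finset.sum_sub_distrib]
      exact sum_mem fun z _ => F.blockMap_d hP _ _
    have h4 := F.grProj_of_mem h3
    rw [map_sub, sub_eq_zero] at h4
    rw [map_sub, map_sub, sub_eq_zero] at h2
    rw [h2, ← h4, F.grProj_sum, h1]
    rfl
  surj t := by
    have := Fintype.ofFinite (SetPartition n s)
    exact ⟨_, sum_mem fun z _ => F.blockMap_mem z.rep (t z), F.grProj_sum t⟩
  ker x hx := by
    have := Fintype.ofFinite (SetPartition n s)
    refine ⟨fun h => ?_, F.grProj_of_mem⟩
    obtain ⟨t, ht⟩ := F.exists_sub_sum_blockMap_mem h0 hx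
    have h1 := F.grProj_of_mem ht
    rw [map_sub, F.grProj_sum, h, zero_sub, neg_eq_zero] at h1
    simpa [h1] using ht

end QuasiFree

/-! ### Generators and indecomposables -/

namespace DGMod

theorem mem_gr_iff {V : DGMod.{u, v} K} {k : ℕ} {x : V} : x ∈ V.gr k ↔ V.proj k x = x := by
  refine ⟨fun h => by rw [proj_of_mem k h, if_pos rfl], fun h => ?_⟩
  rw [← h]
  clear h
  induction x using hom_induction with
  | zero => simp
  | hom l x hx =>
    rw [proj_of_mem k hx]
    split_ifs with h
    · exact h ▸ hx
    · exact zero_mem _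
  | add x y hx hy => rw [map_add]; exact add_mem hx hy

/-- The inverse of a bijective morphism. -/
noncomputable def Hom.inverse {V W : DGMod.{u, v} K} (f : Hom V W) (hf : Function.Bijective f) :
    Hom W V where
  toLin := (LinearEquiv.ofBijective f.toLin hf).symm.toLinearMap
  map_mem k y hy := by
    obtain ⟨x, rfl⟩ := hf.2 y
    rw [mem_gr_iff, ← f.map_proj] at hy
    change (LinearEquiv.ofBijective f.toLin hf).symm (LinearEquiv.ofBijective f.toLin hf x) ∈ V.gr k
    rw [LinearEquiv.symm_apply_apply]
    exact mem_gr_iff.2 (hf.1 hy)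
  map_d y := by
    obtain ⟨x, rfl⟩ := hf.2 y
    rw [← f.map_d]
    change (LinearEquiv.ofBijective f.toLin hf).symm (LinearEquiv.ofBijective f.toLin hf _) =
      V.d ((LinearEquiv.ofBijective f.toLin hf).symm (LinearEquiv.ofBijective f.toLin hf x))
    rw [LinearEquiv.symm_apply_apply, LinearEquiv.symm_apply_apply]

theorem Hom.apply_inverse {V W : DGMod.{u, v} K} (f : Hom V W) (hf : Function.Bijective f) (y : W) :
    f (f.inverse hf y) = y :=
  (LinearEquiv.ofBijective f.toLin hf).apply_symm_apply y

/-- The composite of morphisms. -/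
noncomputable def Hom.comp {V W X : DGMod.{u, v} K} (g : Hom W X) (f : Hom V W) : Hom V X where
  toLin := g.toLin ∘ₗ f.toLin
  map_mem k x hx := g.map_mem k _ (f.map_mem k x hx)
  map_d x := by rw [LinearMap.comp_apply, f.map_d, g.map_d]; rfl

end DGMod

namespace QuasiFree

variable {P : Operad.{u, v} K} {R : LeftModule P} (F : QuasiFree R)

/-- The map from the generators to the indecomposables. -/
noncomputable def toIndecomposables (n : ℕ) : DGMod.Hom (F.gen n) (R.indecomposables n) where
  toLin := (R.decomposables n).mkQ ∘ₗ F.incl n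
  map_mem k x hx := ⟨_, F.incl_mem n k x hx, rfl⟩
  map_d x := by
    refine Eq.symm ?_
    exact (Submodule.Quotient.eq _).2 (F.twist_mem n x)

/-- The element ι y = 1(y) lies in the block with one part. If it is decomposable, its projection to
that block is zero, and P(1) = K 1 allows y to be recovered from the projection. -/
theorem injective_toIndecomposables (hP : P.IsConnected) (h0 : F.gen.IsConnected) (n : ℕ) :
    Function.Injective (F.toIndecomposables n) := by
  rw [injective_iff_map_eq_zero]
  intro y hy
  -- In arity 0 the map to a one-point set is not surjective, so there is no such block.
  rcases Nat.eq_zero_or_pos n with rfl | hn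
  · exact @Subsingleton.elim _ h0 _ _
  have h1 : F.incl n y ∈ F.filt 2 n := by
    rw [F.filt_two hP]; exact (Submodule.Quotient.mk_eq_zero _).1 hy
  obtain ⟨g, u, hg⟩ := F.op_incl_eq (fun _ : Fin 1 => n)
    (finCongr (Fin.sum_univ_one (fun _ : Fin 1 => n)))
  have hgs : Function.Surjective g := fun i => ⟨⟨0, hn⟩, Subsingleton.elim _ _⟩
  have h3 := hg P.one fun _ => y
  have h4 : R.map (finCongr (Fin.sum_univ_one (fun _ : Fin 1 => n)))
      (R.act.comp (fun _ : Fin 1 => n) P.one fun _ => F.incl n y) = F.incl n y := by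
    rw [R.one_act n]
    exact R.map_map_symm (finCongr (Fin.sum_univ_one (fun _ : Fin 1 => n))) _
  rw [h4, ← F.blockMap_pure] at h3
  have h5 := F.blockProj_of_mem g hgs h1
  rw [h3, F.blockProj_blockMap] at h5
  let c : P.obj 1 ≃ₗ[K] K :=
    (LinearEquiv.ofBijective (LinearMap.toSpanSingleton K (P.obj 1) P.one) hP.2).symm
  have hc : c P.one = 1 := by
    rw [LinearEquiv.symm_apply_eq]
    exact (one_smul K P.one).symm
  let ev : MultilinearMap K (fun i : Fin 1 => (F.gen (part g i).card : Type v))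
      (F.gen (part g 0).card) :=
    { toFun := fun z => z 0
      map_update_add' := fun z i x x' => by obtain rfl := Subsingleton.elim i 0; simp
      map_update_smul' := fun z i c x => by obtain rfl := Subsingleton.elim i 0; simp }
  have h6 := congrArg (SgnMod.iterLift 1 (P.obj 1).toSgnMod (fun i => F.gen (part g i).card)
    (c.toLinearMap.smulRight ev)) h5
  rw [SgnMod.iterLift_pure, map_zero, LinearMap.smulRight_apply, LinearEquiv.coe_coe, hc,
    one_smul] at h6
  have h7 : F.gen.map (u 0).symm (F.gen.map (u 0) y) = 0 :=
    (congrArg (F.gen.map (u 0).symm) h6).trans (map_zero _)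
  rwa [← F.gen.map_trans, Equiv.self_trans_symm, F.gen.map_refl] at h7

/-- A composite with one input is a scalar multiple of a generator because P(1) = K 1; with more
inputs it is decomposable. -/
theorem surjective_toIndecomposables (hP : P.IsConnected) (n : ℕ) :
    Function.Surjective (F.toIndecomposables n) := by
  have h : F.filt 1 n ≤ LinearMap.range (F.incl n) ⊔ R.decomposables n := by
    refine Submodule.span_le.2 ?_
    rintro _ ⟨r, k, σ, a, e, p, y, hr, hp, hy, rfl⟩
    by_cases hr1 : r = 1
    · subst hr1
      refine Submodule.mem_sup_left ?_
      obtain ⟨m, rfl⟩ : ∃ m, k = fun _ => m := ⟨k 0, by ext i; rw [Subsingleton.elim i 0]⟩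
      obtain ⟨z, rfl⟩ : ∃ z, y = fun _ => z := ⟨y 0, by ext i; rw [Subsingleton.elim i 0]⟩
      obtain ⟨c, rfl⟩ := hP.2.2 p
      refine ⟨c • F.gen.map ((finCongr (Fin.sum_univ_one (fun _ : Fin 1 => m)).symm).trans σ) z, ?_⟩
      rw [map_smul, F.incl_map, R.map_trans, ← R.one_act m]
      simp
    · exact Submodule.mem_sup_right (LeftModule.mem_decomposables σ hr1 hp fun i =>
        F.incl_mem _ _ _ (hy i))
  intro x
  obtain ⟨x, rfl⟩ := Submodule.mkQ_surjective _ x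
  obtain ⟨_, ⟨y, rfl⟩, z, hz, rfl⟩ := Submodule.mem_sup.1 (h (F.mem_filt_one hP x))
  refine ⟨y, ?_⟩
  rw [map_add, Submodule.mkQ_apply, Submodule.mkQ_apply, (Submodule.Quotient.mk_eq_zero _).2 hz,
    add_zero]
  rfl

theorem bijective_toIndecomposables (hP : P.IsConnected) (h0 : F.gen.IsConnected) (n : ℕ) :
    Function.Bijective (F.toIndecomposables n) :=
  ⟨F.injective_toIndecomposables hP h0 n, F.surjective_toIndecomposables hP n⟩

theorem exactStep_indecomposables (hP : P.IsConnected) (n : ℕ) :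
    ExactStep (R.obj n).d ⊤ (F.filt 2 n) (R.indecomposables n).d (R.decomposables n).mkQ where
  le := le_top
  d_d x _ := (R.obj n).d_d x
  d_mem _ _ := trivial
  d_mem' x hx := F.d_filt hP hx
  map_d x _ := rfl
  surj t := by
    obtain ⟨x, rfl⟩ := Submodule.mkQ_surjective _ t
    exact ⟨x, trivial, rfl⟩
  ker x _ := by
    rw [F.filt_two hP]
    exact Submodule.Quotient.mk_eq_zero _

/-! ### Morphisms -/

variable {P' : Operad.{u, v} K} {R' : LeftModule P'} {φ : Operad.Hom P P'}
  (ψ : LeftModule.Hom R (R'.restrict φ)) {F} {F' : QuasiFree R'}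

theorem hom_op {n r : ℕ} (k : Fin r → ℕ) (σ : Fin (∑ i, k i) ≃ Fin n) (p : P.obj r)
    (y : ∀ i, R.obj (k i)) : ψ.toSymHom.app n (R.map σ (R.act.comp k p y)) =
      R'.map σ (R'.act.comp k (φ.app r p) fun i => ψ.toSymHom.app _ (y i)) := by
  rw [ψ.toSymHom.naturality]
  exact congrArg (R'.map σ) (ψ.map_act k p y)

/-- The images of generators need not be generators, but composites of arbitrary elements respect
the filtration. -/
theorem hom_filt (hP' : P'.IsConnected) {s n : ℕ} {x : R.obj n} (hx : x ∈ F.filt s n) :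
    ψ.toSymHom.app n x ∈ F'.filt s n := by
  refine (Submodule.span_le.2 ?_ : F.filt s n ≤ (F'.filt s n).comap (ψ.toSymHom.app n).toLin) hx
  rintro _ ⟨r, k, σ, a, e, p, y, hr, hp, hy, rfl⟩
  rw [SetLike.mem_coe, Submodule.mem_comap, hom_op]
  exact F'.filt_anti hr n (F'.op_mem_filt hP' _ _ _ _)

/-- The morphism of generators induced by a morphism of quasi-free modules. -/
noncomputable def genHom (F : QuasiFree R) (F' : QuasiFree R') (hP' : P'.IsConnected)
    (h0' : F'.gen.IsConnected) (n : ℕ) : DGMod.Hom (F.gen n) (F'.gen n) :=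
  ((F'.toIndecomposables n).inverse (F'.bijective_toIndecomposables hP' h0' n)).comp
    ((ψ.indecomposablesMap.app n).comp (F.toIndecomposables n))

theorem toIndecomposables_genHom (hP' : P'.IsConnected) (h0' : F'.gen.IsConnected) (n : ℕ)
    (y : F.gen n) : F'.toIndecomposables n (genHom ψ F F' hP' h0' n y) =
      ψ.indecomposablesMap.app n (F.toIndecomposables n y) :=
  DGMod.Hom.apply_inverse _ (F'.bijective_toIndecomposables hP' h0' n) _

theorem hom_incl_sub_mem (hP' : P'.IsConnected) (h0' : F'.gen.IsConnected) (n : ℕ) (y : F.gen n) :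
    ψ.toSymHom.app n (F.incl n y) - F'.incl n (genHom ψ F F' hP' h0' n y) ∈ R'.decomposables n :=
  (Submodule.Quotient.eq _).1 (toIndecomposables_genHom ψ hP' h0' n y).symm

/-- On generators the map is conjugate to ψ̄ under the isomorphisms with the indecomposables. -/
theorem genHom_isQIso (hP : P.IsConnected) (h0 : F.gen.IsConnected) (hP' : P'.IsConnected)
    (h0' : F'.gen.IsConnected) {n : ℕ} (h : (ψ.indecomposablesMap.app n).IsQuasiIso) :
    (genHom ψ F F' hP' h0' n).toSgnHom.IsQIso := by
  rw [DGMod.Hom.isQuasiIso_iff] at h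
  set a := LinearEquiv.ofBijective (F.toIndecomposables n).toLin
    (F.bijective_toIndecomposables hP h0 n) with ha
  set b := LinearEquiv.ofBijective (F'.toIndecomposables n).toLin
    (F'.bijective_toIndecomposables hP' h0' n) with hb
  refine QIso.congr a.symm b.symm (fun x => ?_) (fun x => ?_) (fun x => ?_) h
  · obtain ⟨x, rfl⟩ := a.surjective x
    rw [LinearEquiv.symm_apply_eq, LinearEquiv.symm_apply_apply]
    exact ((F.toIndecomposables n).map_d x).symm
  · obtain ⟨x, rfl⟩ := b.surjective x
    rw [LinearEquiv.symm_apply_eq, LinearEquiv.symm_apply_apply]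
    exact ((F'.toIndecomposables n).map_d x).symm
  · obtain ⟨x, rfl⟩ := a.surjective x
    rw [LinearEquiv.symm_apply_eq, LinearEquiv.symm_apply_apply]
    exact (toIndecomposables_genHom ψ hP' h0' n x).symm

/-- The morphism of blocks induced by `φ` and by the morphism of generators. -/
noncomputable def blockHom (F : QuasiFree R) (F' : QuasiFree R') (hP' : P'.IsConnected)
    (h0' : F'.gen.IsConnected) {n s : ℕ} (f : Fin n → Fin s) :
    SgnMod.Hom (block P.toSymMod F.gen f) (block P'.toSymMod F'.gen f) :=
  SgnMod.iterHom s (φ.app s).toSgnHom fun i => genHom ψ F F' hP' h0' (part f i).card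

/-- On generators ψ agrees with `genHom` modulo decomposables, so the discrepancy on a block lies
one stage deeper. -/
theorem hom_blockMap (hP' : P'.IsConnected) (h0' : F'.gen.IsConnected) {n s : ℕ}
    (f : Fin n → Fin s) (t : block P.toSymMod F.gen f) :
    ψ.toSymHom.app n (F.blockMap f t) - F'.blockMap f (blockHom ψ F F' hP' h0' f t) ∈
      F'.filt (s + 1) n := by
  refine block_induction ((F'.filt (s + 1) n).comap ((ψ.toSymHom.app n).toLin ∘ₗ F.blockMap f -
    F'.blockMap f ∘ₗ (blockHom ψ F F' hP' h0' f).toLin)) (fun a e p y hp hy => ?_) t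
  have h : blockHom ψ F F' hP' h0' f (blockPure P.toSymMod F.gen f p y) =
      blockPure P'.toSymMod F'.gen f (φ.app s p) fun i => genHom ψ F F' hP' h0' _ (y i) :=
    SgnMod.iterHom_pure _ _ _ _
  rw [Submodule.mem_comap, LinearMap.sub_apply, LinearMap.comp_apply, LinearMap.comp_apply, h,
    F.blockMap_pure, F'.blockMap_pure, hom_op]
  exact F'.op_sub_op_mem hP' _ _ _ _ _ fun i => hom_incl_sub_mem ψ hP' h0' _ (y i)

/-- The morphism induced on the sum of the blocks with `s` parts. -/
noncomputable def grHom (F : QuasiFree R) (F' : QuasiFree R') (hP' : P'.IsConnected)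
    (h0' : F'.gen.IsConnected) (n s : ℕ) :
    (∀ z : SetPartition n s, block P.toSymMod F.gen z.rep) →ₗ[K]
      ∀ z : SetPartition n s, block P'.toSymMod F'.gen z.rep :=
  LinearMap.pi fun z => (blockHom ψ F F' hP' h0' z.rep).toLin ∘ₗ LinearMap.proj z

theorem grProj_hom (hP' : P'.IsConnected) (h0 : F.gen.IsConnected)
    (h0' : F'.gen.IsConnected) {n s : ℕ} {x : R.obj n} (hx : x ∈ F.filt s n) :
    F'.grProj n s (ψ.toSymHom.app n x) = grHom ψ F F' hP' h0' n s (F.grProj n s x) := by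
  have := Fintype.ofFinite (SetPartition n s)
  obtain ⟨t, ht⟩ := F.exists_sub_sum_blockMap_mem h0 hx
  have h1 := F.grProj_of_mem ht
  rw [map_sub, F.grProj_sum, sub_eq_zero] at h1
  have h2 := F'.grProj_of_mem (hom_filt (F' := F') ψ hP' ht)
  have h3 : ψ.toSymHom.app n (∑ z, F.blockMap z.rep (t z)) -
      ∑ z, F'.blockMap z.rep (grHom ψ F F' hP' h0' n s t z) ∈ F'.filt (s + 1) n := by
    rw [map_sum, ← Finset.sum_sub_distrib]
    exact sum_mem fun z _ => hom_blockMap ψ hP' h0' _ _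
  have h4 := F'.grProj_of_mem h3
  rw [map_sub, F'.grProj_sum, sub_eq_zero] at h4
  rw [map_sub, map_sub, sub_eq_zero] at h2
  rw [h2, h4, h1]

end QuasiFree

theorem qIso_pi_iff {ι : Type*} {A B : ι → Type*} [∀ i, AddCommGroup (A i)] [∀ i, Module K (A i)]
    [∀ i, AddCommGroup (B i)] [∀ i, Module K (B i)] {dA : ∀ i, A i →ₗ[K] A i}
    {dB : ∀ i, B i →ₗ[K] B i} {f : ∀ i, A i →ₗ[K] B i} :
    QIso (LinearMap.pi fun i => dA i ∘ₗ LinearMap.proj i)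
      (LinearMap.pi fun i => dB i ∘ₗ LinearMap.proj i)
      (LinearMap.pi fun i => f i ∘ₗ LinearMap.proj i) ↔ ∀ i, QIso (dA i) (dB i) (f i) := by
  classical
  simp only [qIso_iff]
  constructor
  · intro h i x y hx hy
    obtain ⟨z, w, h1, h2⟩ := h (Pi.single i x) (Pi.single i y) (by
      ext j
      by_cases hj : j = i
      · subst hj; simpa using hx
      · simp [hj]) (by
      ext j
      by_cases hj : j = i
      · subst hj; simpa using hy
      · simp [hj])
    exact ⟨z i, w i, by simpa using congrFun h1 i, by simpa using congrFun h2 i⟩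
  · intro h x y hx hy
    choose z w h1 h2 using fun i => h i (x i) (y i) (congrFun hx i) (congrFun hy i)
    exact ⟨z, w, funext h1, funext h2⟩

/-! ### Comparison of the filtrations -/

/-- The strict inequality drives the induction on arity in (b). -/
theorem card_part_lt {n s : ℕ} {f : Fin n → Fin s} (hf : Function.Surjective f) (hs : 2 ≤ s)
    (i : Fin s) : (part f i).card < n := by
  have : Nontrivial (Fin s) := Fin.nontrivial_iff_two_le.2 hs
  obtain ⟨j, hj⟩ := exists_ne i
  obtain ⟨a, ha⟩ := hf j
  have h : part f i ⊂ Finset.univ :=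
    Finset.ssubset_univ_iff.2 fun h => hj (by
      have := h ▸ Finset.mem_univ a
      simpa [part, ha] using this)
  simpa using Finset.card_lt_card h

theorem card_part_eq_one {n : ℕ} {f : Fin n → Fin n} (hf : Function.Surjective f) (i : Fin n) :
    (part f i).card = 1 := by
  have hb : Function.Injective f := Finite.injective_iff_surjective.2 hf
  obtain ⟨a, ha⟩ := hf i
  rw [Finset.card_eq_one]
  refine ⟨a, ?_⟩
  ext b
  simp [part, ← ha, hb.eq_iff]

theorem DGMod.Hom.isQuasiIso_of_bijective {V W : DGMod.{u, v} K} {f : DGMod.Hom V W}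
    (hf : Function.Bijective f) : f.IsQuasiIso := by
  rw [f.isQuasiIso_iff, qIso_iff]
  intro x y hx hy
  obtain ⟨z, rfl⟩ := hf.2 y
  refine ⟨z, 0, hf.1 ?_, by simp⟩
  exact hy.trans (f.map_d z).symm

theorem Operad.Hom.bijective_app_zero {P P' : Operad.{u, v} K} (φ : Operad.Hom P P')
    (hP : P.IsConnected) (hP' : P'.IsConnected) : Function.Bijective (φ.app 0) := by
  have := hP.1
  have := hP'.1
  exact ⟨fun _ _ _ => Subsingleton.elim _ _, fun y => ⟨0, Subsingleton.elim _ _⟩⟩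

/-- Both sides are free on the operad unit, which φ preserves. -/
theorem Operad.Hom.bijective_app_one {P P' : Operad.{u, v} K} (φ : Operad.Hom P P')
    (hP : P.IsConnected) (hP' : P'.IsConnected) : Function.Bijective (φ.app 1) := by
  rw [← Function.Bijective.of_comp_iff _ hP.2]
  convert hP'.2 using 1
  ext c
  simp [φ.map_one]

namespace QuasiFree

variable {P P' : Operad.{u, v} K} {φ : Operad.Hom P P'} {R : LeftModule P} {R' : LeftModule P'}
  {ψ : LeftModule.Hom R (R'.restrict φ)} {F : QuasiFree R} {F' : QuasiFree R'}

/-- The restriction of `ψ` to the elements of filtration `s` in arity `n` is a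
quasi-isomorphism. -/
def FiltQIso (ψ : LeftModule.Hom R (R'.restrict φ)) (F : QuasiFree R) (F' : QuasiFree R')
    (s n : ℕ) : Prop :=
  QIsoOn (R.obj n).d (R'.obj n).d (ψ.toSymHom.app n).toLin (F.filt s n) (F'.filt s n)

theorem cone_exactStep (hP : P.IsConnected) (hP' : P'.IsConnected) (h0 : F.gen.IsConnected)
    (h0' : F'.gen.IsConnected) (s n : ℕ) :
    ExactStep (coneD (R.obj n).d (R'.obj n).d (ψ.toSymHom.app n).toLin)
      ((F'.filt s n).prod (F.filt s n)) ((F'.filt (s + 1) n).prod (F.filt (s + 1) n))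
      (coneD (grD P.toSymMod F.gen n s) (grD P'.toSymMod F'.gen n s) (grHom ψ F F' hP' h0' n s))
      ((F'.grProj n s).prodMap (F.grProj n s)) :=
  (F.exactStep hP h0 n s).cone (F'.exactStep hP' h0' n s) (ψ.toSymHom.app n).map_d
    (fun _ => hom_filt ψ hP') (fun _ => hom_filt ψ hP') fun _ => grProj_hom ψ hP' h0 h0'

theorem acyclicOn_gr_iff (hP' : P'.IsConnected) (h0' : F'.gen.IsConnected) (s n : ℕ) :
    AcyclicOn (coneD (grD P.toSymMod F.gen n s) (grD P'.toSymMod F'.gen n s)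
      (grHom ψ F F' hP' h0' n s)) ⊤ ↔
      ∀ z : SetPartition n s, (blockHom ψ F F' hP' h0' z.rep).IsQIso := by
  have h := qIso_pi_iff (dA := fun z : SetPartition n s => (block P.toSymMod F.gen z.rep).d)
    (dB := fun z : SetPartition n s => (block P'.toSymMod F'.gen z.rep).d)
    (f := fun z => (blockHom ψ F F' hP' h0' z.rep).toLin)
  rwa [QIso, QIsoOn, Submodule.prod_top] at h

theorem filtQIso_of_lt (h0 : F.gen.IsConnected) (h0' : F'.gen.IsConnected) {s n : ℕ} (h : n < s) :
    FiltQIso ψ F F' s n :=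
  QIsoOn.of_eq_bot (F.filt_eq_bot h0 h) (F'.filt_eq_bot h0' h)

theorem cone_exactStep_indecomposables (hP : P.IsConnected) (hP' : P'.IsConnected)
    (F : QuasiFree R) (F' : QuasiFree R') (n : ℕ) :
    ExactStep (coneD (R.obj n).d (R'.obj n).d (ψ.toSymHom.app n).toLin)
      ((⊤ : Submodule K (R'.obj n)).prod (⊤ : Submodule K (R.obj n)))
      ((F'.filt 2 n).prod (F.filt 2 n))
      (coneD (R.indecomposables n).d (R'.indecomposables n).d (ψ.indecomposablesMap.app n).toLin)
      ((R'.decomposables n).mkQ.prodMap (R.decomposables n).mkQ) :=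
  (F.exactStep_indecomposables hP n).cone (F'.exactStep_indecomposables hP' n)
    (ψ.toSymHom.app n).map_d (fun _ _ => trivial) (fun _ => hom_filt ψ hP') fun _ _ => rfl

theorem acyclicOn_indecomposables_iff (n : ℕ) :
    AcyclicOn (coneD (R.indecomposables n).d (R'.indecomposables n).d
      (ψ.indecomposablesMap.app n).toLin) ⊤ ↔ (ψ.indecomposablesMap.app n).IsQuasiIso := by
  rw [DGMod.Hom.isQuasiIso_iff, QIso, QIsoOn, Submodule.prod_top]

theorem acyclicOn_iff (n : ℕ) :
    AcyclicOn (coneD (R.obj n).d (R'.obj n).d (ψ.toSymHom.app n).toLin)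
      ((⊤ : Submodule K (R'.obj n)).prod (⊤ : Submodule K (R.obj n))) ↔
      (ψ.app n).IsQuasiIso :=
  (ψ.toSymHom.app n).isQuasiIso_iff.symm

theorem blockHom_isQIso (hP : P.IsConnected) (hP' : P'.IsConnected) (h0 : F.gen.IsConnected)
    (h0' : F'.gen.IsConnected) (hproj : F.gen.IsProjective) (hproj' : F'.gen.IsProjective)
    {s n : ℕ} (hs : 2 ≤ s) (hφ : (φ.app s).IsQuasiIso)
    (hψ : ∀ m < n, (ψ.indecomposablesMap.app m).IsQuasiIso) (z : SetPartition n s) :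
    (blockHom ψ F F' hP' h0' z.rep).IsQIso :=
  SgnMod.iterHom_isQIso (fun _ => hproj _) (fun _ => hproj' _)
    ((φ.app s).isQuasiIso_iff.1 hφ) fun i =>
      genHom_isQIso ψ hP h0 hP' h0' (hψ _ (card_part_lt z.rep_surjective hs i))

theorem filtQIso_two (hP : P.IsConnected) (hP' : P'.IsConnected) (h0 : F.gen.IsConnected)
    (h0' : F'.gen.IsConnected) (hproj : F.gen.IsProjective) (hproj' : F'.gen.IsProjective)
    (hφ : φ.IsQuasiIso) {n : ℕ} (hψ : ∀ m < n, (ψ.indecomposablesMap.app m).IsQuasiIso) :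
    FiltQIso ψ F F' 2 n := by
  -- Descending induction on s from stage n + 1, which is zero; l bounds the distance to it.
  have key : ∀ l s, 2 ≤ s → n < s + l → FiltQIso ψ F F' s n := by
    intro l
    induction l with
    | zero => exact fun s _ h => filtQIso_of_lt h0 h0' h
    | succ l ih =>
      intro s hs h
      refine (cone_exactStep hP hP' h0 h0' s n).middle (ih (s + 1) (by omega) (by omega)) ?_
      rw [acyclicOn_gr_iff]
      exact blockHom_isQIso hP hP' h0 h0' hproj hproj' hs (hφ s) hψ
  exact key n 2 le_rfl (by omega)

end QuasiFree

end OperadicModules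

/-! ### The three implications -/

theorem mainTheorem7 {K : Type u} [CommRing K] {P P' : Operad.{u, v} K}
    (hP : P.IsConnected) (hP' : P'.IsConnected) (φ : Operad.Hom P P')
    {R : LeftModule P} {R' : LeftModule P'} (ψ : LeftModule.Hom R (R'.restrict φ))
    (F : QuasiFree R) (F' : QuasiFree R')
    (h0 : F.gen.IsConnected) (h0' : F'.gen.IsConnected)
    (hproj : F.gen.IsProjective) (hproj' : F'.gen.IsProjective) :
    (φ.IsQuasiIso → ψ.indecomposablesMap.IsQuasiIso → ψ.IsQuasiIso) ∧
    (φ.IsQuasiIso → ψ.IsQuasiIso → ψ.indecomposablesMap.IsQuasiIso) ∧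
    ((F.gen 1).IsGroundRing → (F'.gen 1).IsGroundRing →
      ψ.IsQuasiIso → ψ.indecomposablesMap.IsQuasiIso → φ.IsQuasiIso) := by
  refine ⟨fun hφ hψ n => ?_, fun hφ hψ n => ?_, fun hg hg' hψ hψ' n => ?_⟩
  · rw [← QuasiFree.acyclicOn_iff]
    refine (QuasiFree.cone_exactStep_indecomposables hP hP' F F' n).middle
      (QuasiFree.filtQIso_two hP hP' h0 h0' hproj hproj' hφ fun m _ => hψ m) ?_
    rw [QuasiFree.acyclicOn_indecomposables_iff]
    exact hψ n
  · induction n using Nat.strong_induction_on with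
    | _ n ih =>
      rw [← QuasiFree.acyclicOn_indecomposables_iff]
      exact (QuasiFree.cone_exactStep_indecomposables hP hP' F F' n).right
        (QuasiFree.filtQIso_two hP hP' h0 h0' hproj hproj' hφ ih)
        ((QuasiFree.acyclicOn_iff n).2 (hψ n))
  · induction n using Nat.strong_induction_on with
    | _ n ih =>
      rcases Nat.lt_or_ge n 2 with hn | hn
      · interval_cases n
        · exact DGMod.Hom.isQuasiIso_of_bijective (φ.bijective_app_zero hP hP')
        · exact DGMod.Hom.isQuasiIso_of_bijective (φ.bijective_app_one hP hP')
      -- Stage 2 is the kernel of the passage to indecomposables, so it is compared by ψ and ψ̄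
      -- without any knowledge of φ.
      have h2 : QuasiFree.FiltQIso ψ F F' 2 n :=
        (QuasiFree.cone_exactStep_indecomposables hP hP' F F' n).left
          ((QuasiFree.acyclicOn_iff n).2 (hψ n))
          ((QuasiFree.acyclicOn_indecomposables_iff n).2 (hψ' n))
      -- Passing from stage s to s + 1 uses φ(s); stopping at s = n keeps this within the induction
      -- hypothesis s < n.
      have hs : ∀ s, 2 ≤ s → s ≤ n → QuasiFree.FiltQIso ψ F F' s n := by
        intro s hs
        induction s, hs using Nat.le_induction with
        | base => exact fun _ => h2
        | succ s hs ihs =>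
          intro hsn
          refine (QuasiFree.cone_exactStep hP hP' h0 h0' s n).left (ihs (by omega)) ?_
          rw [QuasiFree.acyclicOn_gr_iff]
          exact QuasiFree.blockHom_isQIso hP hP' h0 h0' hproj hproj' hs (ih s hsn) fun m _ => hψ' m
      -- As stage n + 1 is zero, the graded piece of index n is stage n itself.
      have hgr := (QuasiFree.cone_exactStep hP hP' h0 h0' n n).right
        (QuasiFree.filtQIso_of_lt h0 h0' n.lt_succ_self) (hs n hn le_rfl)
      rw [QuasiFree.acyclicOn_gr_iff] at hgr
      -- The partition into singletons: every factor is then a generator module of arity 1, and the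
      -- rank-one factors can be cancelled.
      obtain ⟨z, -⟩ := SetPartition.exists_rep (Function.surjective_id (α := Fin n))
      rw [DGMod.Hom.isQuasiIso_iff]
      refine SgnMod.of_iterHom_isQIso (f := (φ.app n).toSgnHom) (fun i => ?_) (fun i => ?_)
        (fun i => ?_) (hgr z)
      · rw [card_part_eq_one z.rep_surjective i]; exact hg
      · rw [card_part_eq_one z.rep_surjective i]; exact hg'
      · exact QuasiFree.genHom_isQIso ψ hP h0 hP' h0' (hψ' _)
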